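/- Let $k\in\mathbb N$, let $\mathbf n=(n_1,\dots,n_k)$, $\mathbf m=(m_1,\dots,m_k)$ with $n_i,m_i\in\{1,2,\dots\}$, and let $\mathcal K$ be a complex Hilbert space. Let $\mathbb F_{n_i}^+$ be the unital free semigroup on generators $g_1^i,\dots,g_{n_i}^i$ with identity $g_0^i$, let $|\alpha|$ be the length of a word $\alpha$, and put $\mathbf F_{\mathbf n}^+:=\mathbb F_{n_1}^+\times\cdots\times\mathbb F_{n_k}^+$. Let $F^2(H_{n_i})$ be the full Fock space with orthonormal basis $\{e^i_\alpha\}_{\alpha\in\mathbb F_{n_i}^+}$, and $e_{\boldsymbol\gamma}:=e^1_{\gamma_1}\otimes\cdots\otimes e^k_{\gamma_k}$. Put $b_{i,\alpha}:=\binom{|\alpha|+m_i-1}{m_i-1}$, and let $W_{i,j}$ be the bounded operator on $F^2(H_{n_i})$ with $W_{i,j}e^i_\alpha=\sqrt{b_{i,\alpha}/b_{i,g_j\alpha}}\;e^i_{g_j\alpha}$. Let $\mathbf W_{i,j}$ be $W_{i,j}$ acting on the $i$-th factor of $\bigotimes_{s=1}^kF^2(H_{n_s})$, $\mathbf W_{i,\alpha}:=\mathbf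 W_{i,j_1}\cdots\mathbf W_{i,j_p}$ for $\alpha=g^i_{j_1}\cdots g^i_{j_p}$, and $\mathbf W_{\boldsymbol\alpha}:=\mathbf W_{1,\alpha_1}\cdots\mathbf W_{k,\alpha_k}$. Let $\mathcal P_{\mathcal K}$ be the linear span of the vectors $x\otimes e_{\boldsymbol\gamma}$, $x\in\mathcal K$, $\boldsymbol\gamma\in\mathbf F_{\mathbf n}^+$. For $s\in\mathbb Z$ write $s^+=\max\{s,0\}$, $s^-=\max\{-s,0\}$. Let $\mathcal J$ be the set of all $(\boldsymbol\alpha,\boldsymbol\beta)\in\mathbf F_{\mathbf n}^+\times\mathbf F_{\mathbf n}^+$ for which there is $(s_1,\dots,s_k)\in\mathbb Z^k$ with $|\alpha_i|=s_i^+$ and $|\beta_i|=s_i^-$ for all $i$. Let $\mathcal C$ be the set of comparable pairs $(\boldsymbol\omega,\boldsymbol\gamma)$: for each $i$, $\omega_i=\sigma\gamma_i$ or $\gamma_i=\sigma\omega_i$ for some $\sigma\in\mathbb F_{n_i}^+$. For such a pair let $\mathbf s(\boldsymbol\omega,\boldsymbol\gamma)=(\boldsymbol\sigma,\boldsymbol\beta)\in\mathcal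 J$, where $\sigma_i$ is the word with $\omega_i=\sigma_i\gamma_i$ if there is one, and $\sigma_i=g_0^i$ otherwise; $\beta_i$ is the word with $\gamma_i=\beta_i\omega_i$ if there is one, and $\beta_i=g^i_0$ otherwise; and let $$\tau_{(\boldsymbol\omega,\boldsymbol\gamma)}:=\prod_{i=1}^k\sqrt{\frac{b_{i,\min\{\omega_i,\gamma_i\}}}{b_{i,\max\{\omega_i,\gamma_i\}}}},$$ where $\min\{\omega_i,\gamma_i\}$ and $\max\{\omega_i,\gamma_i\}$ are the shorter and the longer of the two words. An operator $T\in B(\mathcal K\otimes\bigotimes_{s=1}^kF^2(H_{n_s}))$ is called weighted multi-Toeplitz if there are operators $\{B_{(\boldsymbol\alpha,\boldsymbol\beta)}\}_{(\boldsymbol\alpha,\boldsymbol\beta)\in\mathcal J}\subset B(\mathcal K)$ such that, for all $\boldsymbol\omega,\boldsymbol\gamma\in\mathbf F_{\mathbf n}^+$ and $x,y\in\mathcal K$, the number $\langle T(x\otimes e_{\boldsymbol\gamma}),y\otimes e_{\boldsymbol\omega}\rangle$ equals $\tau_{(\boldsymbol\omega,\boldsymbol\gamma)}\langle B_{\mathbf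 s(\boldsymbol\omega,\boldsymbol\gamma)}x,y\rangle$ if $(\boldsymbol\omega,\boldsymbol\gamma)\in\mathcal C$, and $0$ otherwise. Let $\{A_{(\boldsymbol\alpha,\boldsymbol\beta)}\}_{(\boldsymbol\alpha,\boldsymbol\beta)\in\mathcal J}\subset B(\mathcal K)$, and consider the formal series $$\varphi(\mathbf W,\mathbf W^*):=\sum_{(\boldsymbol\alpha,\boldsymbol\beta)\in\mathcal J}A_{(\boldsymbol\alpha,\boldsymbol\beta)}\otimes\mathbf W_{\boldsymbol\alpha}\mathbf W_{\boldsymbol\beta}^*=\sum_{s\in\mathbb Z^k}q_{s_1,\dots,s_k}(\mathbf W,\mathbf W^*),$$ where $q_{s_1,\dots,s_k}(\mathbf W,\mathbf W^*)$ is the finite sum of the terms with $|\alpha_i|=s_i^+$, $|\beta_i|=s_i^-$ for all $i$. It is called the formal Fourier representation of a weighted multi-Toeplitz operator $T$ if, for every $p\in\mathcal P_{\mathcal K}$, the series $\varphi(\mathbf W,\mathbf W^*)p:=\sum_{(\boldsymbol\alpha,\boldsymbol\beta)\in\mathcal J}(A_{(\boldsymbol\alpha,\boldsymbol\beta)}\otimes\mathbf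 W_{\boldsymbol\alpha}\mathbf W_{\boldsymbol\beta}^*)p$ converges to $Tp$. For $r\in[0,1)$ let $$\varphi(r\mathbf W,r\mathbf W^*):=\sum_{s\in\mathbb Z^k}r^{|s_1|+\cdots+|s_k|}q_{s_1,\dots,s_k}(\mathbf W,\mathbf W^*)$$ whenever this converges in the operator norm, and for $p\in\mathcal P_{\mathcal K}$ let $\varphi(r\mathbf W,r\mathbf W^*)p:=\sum_{(\boldsymbol\alpha,\boldsymbol\beta)\in\mathcal J}r^{\sum_i(|\alpha_i|+|\beta_i|)}(A_{(\boldsymbol\alpha,\boldsymbol\beta)}\otimes\mathbf W_{\boldsymbol\alpha}\mathbf W_{\boldsymbol\beta}^*)p$. All these sums are unordered. Then the following statements are equivalent. (i) For each $\boldsymbol\gamma\in\mathbf F_{\mathbf n}^+$ the series $\sum_{\boldsymbol\omega:(\boldsymbol\omega,\boldsymbol\gamma)\in\mathcal C}\tau_{(\boldsymbol\omega,\boldsymbol\gamma)}^2A_{\mathbf s(\boldsymbol\omega,\boldsymbol\gamma)}^*A_{\mathbf s(\boldsymbol\omega,\boldsymbol\gamma)}$ converges in the weak operator topology, and $\sup_{r\in[0,1)}\sup_{p\in\mathcal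 P_{\mathcal K},\|p\|\le1}\|\varphi(r\mathbf W,r\mathbf W^*)p\|<\infty$ (the series $\varphi(r\mathbf W,r\mathbf W^*)p$ being convergent). (ii) $\varphi(\mathbf W,\mathbf W^*)$ is the formal Fourier representation of a weighted multi-Toeplitz operator $T$. (iii) For each $r\in[0,1)$ the series $\varphi(r\mathbf W,r\mathbf W^*)$ converges in the operator norm topology, and $\sup_{r\in[0,1)}\|\varphi(r\mathbf W,r\mathbf W^*)\|<\infty$. (iv) There is $M>0$ such that $\|q_{s_1,\dots,s_k}(\mathbf W,\mathbf W^*)\|\le M$ for all $(s_1,\dots,s_k)\in\mathbb Z^k$, and $\sup_{r\in[0,1)}\|\varphi(r\mathbf W,r\mathbf W^*)\|<\infty$ (the first condition makes these series norm convergent). In this case, for every $T$ as in (ii), $T=\text{SOT-}\lim_{r\to1}\varphi(r\mathbf W,r\mathbf W^*)$ and $\|T\|=\sup_{r\in[0,1)}\|\varphi(r\mathbf W,r\mathbf W^*)\|$. -/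

import Mathlib

open scoped ENNReal

noncomputable section

namespace PolyHyperball

/-! ### Words -/

/-- `𝔽⁺_{n₁} × ⋯ × 𝔽⁺_{n_k}`: the `k`-tuples of words, the `i`-th one in the unital free semigroup on
`n i` generators. -/
abbrev MultiWord {k : ℕ} (n : Fin k → ℕ) : Type := ∀ i : Fin k, FreeMonoid (Fin (n i))

/-- `ω ≥_r γ`: the word `γ` is a right divisor of the word `ω`. -/
def RightGE {a : Type*} (ω γ : FreeMonoid a) : Prop := ∃ σ : FreeMonoid a, ω = σ * γ

/-- If `ω ≥_r γ`, this is `ω \_r γ`, the unique word `σ` with `ω = σ * γ`; otherwise it is the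
identity `g₀`. -/
def rightQuot {a : Type*} (ω γ : FreeMonoid a) : FreeMonoid a :=
  open Classical in if h : RightGE ω γ then h.choose else 1

/-- `b_α^{(m)} = binom(p + m - 1, m - 1)` for a word `α` of length `p` (it is `1` for `p = 0`). -/
def bCoeff (m p : ℕ) : ℕ := (p + m - 1).choose (m - 1)

section Words

variable {k : ℕ} {n : Fin k → ℕ}

/-- The pair `(ω, γ)` belongs to `𝒞`, that is, `ω` and `γ` are comparable. -/
def Comparable (ω γ : MultiWord n) : Prop := ∀ i, RightGE (ω i) (γ i) ∨ RightGE (γ i) (ω i)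

/-- Pairs `(α, β)` with `|α i| = (s i)⁺` and `|β i| = (s i)⁻` for every `i`. -/
def HasDegree (s : Fin k → ℤ) (c : MultiWord n × MultiWord n) : Prop :=
  ∀ i, ((c.1 i).length : ℤ) = (s i)⁺ ∧ ((c.2 i).length : ℤ) = (s i)⁻

variable (n) in
/-- The index set `𝒥`. -/
def J : Set (MultiWord n × MultiWord n) := {c | ∃ s : Fin k → ℤ, HasDegree s c}

theorem simplify_mem {ω γ : MultiWord n} (_h : Comparable ω γ) :
    ((fun i => rightQuot (ω i) (γ i), fun i => rightQuot (γ i) (ω i)) :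
      MultiWord n × MultiWord n) ∈ J n := by
  have key : ∀ i, (rightQuot (ω i) (γ i)).length = 0 ∨ (rightQuot (γ i) (ω i)).length = 0 := by
    intro i
    by_cases h1 : RightGE (ω i) (γ i)
    · by_cases h2 : RightGE (γ i) (ω i)
      · left
        have e1 := congrArg FreeMonoid.length h1.choose_spec
        have e2 := congrArg FreeMonoid.length h2.choose_spec
        rw [FreeMonoid.length_mul] at e1 e2
        rw [rightQuot, dif_pos h1]
        omega
      · right
        rw [rightQuot, dif_neg h2, FreeMonoid.length_one]
    · left
      rw [rightQuot, dif_neg h1, FreeMonoid.length_one]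
  refine ⟨fun i => (rightQuot (ω i) (γ i)).length - (rightQuot (γ i) (ω i)).length, fun i => ?_⟩
  simp only [posPart_def, negPart_def]
  rcases key i with h | h <;> rw [h] <;> simp

/-- The simplification function `𝐬 : 𝒞 → 𝒥`. -/
def simplify (ω γ : MultiWord n) (h : Comparable ω γ) : J n :=
  ⟨(fun i => rightQuot (ω i) (γ i), fun i => rightQuot (γ i) (ω i)), simplify_mem h⟩

/-- The weight `τ_{(ω, γ)}`. For comparable words `ω i`, `γ i` the smaller (larger) one is the
shorter (longer) one, and `b` depends only on the length. -/
def tau (m : Fin k → ℕ) (ω γ : MultiWord n) : ℝ :=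
  ∏ i, √((bCoeff (m i) (min (ω i).length (γ i).length) : ℝ) /
    bCoeff (m i) (max (ω i).length (γ i).length))

/-- The length `|(α, β)|`. -/
def totalLength (c : MultiWord n × MultiWord n) : ℕ :=
  ∑ i, ((c.1 i).length + (c.2 i).length)

/-- Left multiplication of the `i`-th word by the generator `g_j`. -/
def consAt (i : Fin k) (j : Fin (n i)) (γ : MultiWord n) : MultiWord n :=
  Function.update γ i (FreeMonoid.of j * γ i)

theorem consAt_injective (i : Fin k) (j : Fin (n i)) :
    Function.Injective (consAt (n := n) i j) := by
  intro γ δ h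
  funext l
  have hl := congrFun h l
  by_cases hli : l = i
  · subst hli
    simpa [consAt] using hl
  · simpa [consAt, hli] using hl

theorem finite_hasDegree (s : Fin k → ℤ) :
    {c : J n | HasDegree s c.1}.Finite := by
  have h1 : ∀ N : Fin k → ℕ, {α : MultiWord n | ∀ i, (α i).length = N i}.Finite := fun N =>
    Set.Finite.pi' fun i =>
      (List.finite_length_eq (Fin (n i)) (N i)).subset fun _ (h : FreeMonoid.length _ = _) => h
  refine Set.Finite.of_finite_image (f := Subtype.val) ?_ Subtype.val_injective.injOn
  refine ((h1 fun i => (s i)⁺.toNat).prod (h1 fun i => (s i)⁻.toNat)).subset ?_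
  rintro _ ⟨c, hc, rfl⟩
  refine ⟨fun i => ?_, fun i => ?_⟩
  · have := (hc i).1
    omega
  · have := (hc i).2
    omega

end Words

/-! ### The Hilbert space `𝒦 ⊗ F²(H_{n₁}) ⊗ ⋯ ⊗ F²(H_{n_k})` -/

section Operators

variable {k : ℕ} (n : Fin k → ℕ) (K : Type*) [NormedAddCommGroup K] [InnerProductSpace ℂ K]

/-- `𝒦 ⊗ F²(H_{n₁}) ⊗ ⋯ ⊗ F²(H_{n_k})`. As the vectors
`e_γ = e¹_{γ₁} ⊗ ⋯ ⊗ eᵏ_{γ_k}` form an orthonormal basis of the tensor product of the full Fock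
spaces, this Hilbert space is `ℓ²` of the set of multi-words with values in `𝒦`: the element
`∑ x_γ ⊗ e_γ` is the family `(x_γ)`. -/
abbrev MultiFock : Type _ := lp (fun _ : MultiWord n => K) 2

variable {n K}

/-- The elementary tensor `x ⊗ e_γ`. -/
def basisTensor (x : K) (γ : MultiWord n) : MultiFock n K :=
  open Classical in lp.single 2 γ x

theorem inner_basisTensor (x y : K) (γ ω : MultiWord n) :
    inner ℂ (basisTensor y ω) (basisTensor x γ) =
      open Classical in if ω = γ then inner ℂ y x else 0 := by
  classical
  unfold basisTensor
  rw [lp.inner_single_left, lp.single_apply]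
  by_cases h : ω = γ
  · subst h; simp
  · simp [h]

variable (n K) in
/-- `𝒫_𝒦`: the linear span of the vectors `x ⊗ e_γ`. -/
def polynomials : Submodule ℂ (MultiFock n K) :=
  Submodule.span ℂ {v | ∃ (x : K) (γ : MultiWord n), v = basisTensor x γ}

theorem memlp_entrywise (B : MultiWord n → K →L[ℂ] K) (C : ℝ) (hB : ∀ γ, ‖B γ‖ ≤ C)
    (f : MultiFock n K) : Memℓp (fun γ => B γ (f γ)) 2 := by
  refine Memℓp.mono (g := fun γ => C * ‖f γ‖)
    (((memℓp_norm_iff).2 (lp.memℓp f)).const_mul C) fun γ => ?_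
  exact ((B γ).le_opNorm _).trans (mul_le_mul_of_nonneg_right (hB γ) (norm_nonneg _))

/-- The block diagonal operator `x ⊗ e_γ ↦ B_γ x ⊗ e_γ` of a bounded family `(B_γ)`. -/
def entrywise (B : MultiWord n → K →L[ℂ] K) (C : ℝ) (hC : 0 ≤ C) (hB : ∀ γ, ‖B γ‖ ≤ C) :
    MultiFock n K →L[ℂ] MultiFock n K :=
  LinearMap.mkContinuous
    { toFun := fun f => ⟨fun γ => B γ (f γ), memlp_entrywise B C hB f⟩
      map_add' := fun f g => by ext γ; exact map_add (B γ) (f γ) (g γ)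
      map_smul' := fun c f => by ext γ; exact map_smul (B γ) c (f γ) }
    C
    (fun f => by
      have h2 : (0 : ℝ) < (2 : ℝ≥0∞).toReal := by norm_num
      refine lp.norm_le_of_forall_sum_le h2 (mul_nonneg hC (norm_nonneg _)) fun s => ?_
      rw [Real.mul_rpow hC (norm_nonneg _)]
      refine le_trans ?_ (mul_le_mul_of_nonneg_left (lp.sum_rpow_le_norm_rpow h2 f s)
        (Real.rpow_nonneg hC _))
      rw [Finset.mul_sum]
      refine Finset.sum_le_sum fun γ _ => ?_
      rw [← Real.mul_rpow hC (norm_nonneg _)]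
      exact Real.rpow_le_rpow (norm_nonneg _) (((B γ).le_opNorm _).trans
        (mul_le_mul_of_nonneg_right (hB γ) (norm_nonneg _))) h2.le)

/-- `A ⊗ I`, that is `x ⊗ e_γ ↦ A x ⊗ e_γ`. -/
def coeffOp (n : Fin k → ℕ) (A : K →L[ℂ] K) : MultiFock n K →L[ℂ] MultiFock n K :=
  entrywise (fun _ => A) ‖A‖ (norm_nonneg _) fun _ => le_rfl

/-- `√(b_α / b_{g_j α})` for a word `α` of length `p`. -/
def dWeight (m p : ℕ) : ℝ := √((bCoeff m p : ℝ) / bCoeff m (p + 1))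

theorem norm_dWeight_smul_le (m p : ℕ) :
    ‖((dWeight m p : ℝ) : ℂ) • ContinuousLinearMap.id ℂ K‖ ≤ 1 := by
  have h1 : dWeight m p ≤ 1 := by
    refine Real.sqrt_le_one.2 (div_le_one_of_le₀ ?_ (Nat.cast_nonneg _))
    exact_mod_cast Nat.choose_le_choose _ (by omega)
  have h0 : 0 ≤ dWeight m p := Real.sqrt_nonneg _
  refine ContinuousLinearMap.opNorm_le_bound _ zero_le_one fun x => ?_
  rw [_root_.smul_apply, ContinuousLinearMap.id_apply, norm_smul, Complex.norm_real,
    Real.norm_of_nonneg h0]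
  exact mul_le_mul_of_nonneg_right h1 (norm_nonneg _)

/-- `I_𝒦 ⊗ 𝐃_i`: the diagonal operator `x ⊗ e_γ ↦ √(b_{γ_i} / b_{g_j γ_i}) x ⊗ e_γ` (the weight
does not depend on `j`). -/
def diagOp (m : Fin k → ℕ) (i : Fin k) : MultiFock n K →L[ℂ] MultiFock n K :=
  entrywise (fun γ => ((dWeight (m i) (γ i).length : ℝ) : ℂ) • ContinuousLinearMap.id ℂ K) 1
    zero_le_one fun _ => norm_dWeight_smul_le _ _

theorem inner_basisTensor_consAt (i : Fin k) (j : Fin (n i)) {γ δ : MultiWord n} (h : γ ≠ δ)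
    (x y : K) :
    inner ℂ (basisTensor x (consAt i j γ)) (basisTensor y (consAt i j δ)) = 0 := by
  rw [inner_basisTensor, if_neg fun e => h (consAt_injective i j e)]

open Classical in
/-- The isometric embedding `x ↦ x ⊗ e_γ`. -/
def basisTensorIsometry (γ : MultiWord n) : K →ₗᵢ[ℂ] MultiFock n K where
  toFun x := basisTensor x γ
  map_add' x y := lp.single_add (E := fun _ : MultiWord n => K) 2 γ x y
  map_smul' c x := lp.single_smul (E := fun _ : MultiWord n => K) 2 γ c x
  norm_map' x := lp.norm_single (E := fun _ : MultiWord n => K) (p := 2) (by norm_num) γ x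

variable [CompleteSpace K]

/-- `I_𝒦 ⊗ 𝐒_{i,j}`, the left creation operator by `e_j` in the `i`-th factor:
`∑ x_γ ⊗ e_γ ↦ ∑ x_γ ⊗ e_{(γ₁, …, g_j γ_i, …, γ_k)}`. -/
def leftCreation (i : Fin k) (j : Fin (n i)) : MultiFock n K →L[ℂ] MultiFock n K :=
  (OrthogonalFamily.linearIsometry (𝕜 := ℂ) (G := fun _ : MultiWord n => K)
    (V := fun γ => basisTensorIsometry (consAt i j γ))
    fun _ _ h x y => inner_basisTensor_consAt i j h x y).toContinuousLinearMap

/-- `I_𝒦 ⊗ 𝐖_{i,j}`, the weighted left creation operators. -/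
def W (m : Fin k → ℕ) (i : Fin k) (j : Fin (n i)) : MultiFock n K →L[ℂ] MultiFock n K :=
  leftCreation i j ∘L diagOp m i

/-- `I_𝒦 ⊗ 𝐖_{i,α}` for a word `α = g_{j₁} ⋯ g_{j_p}`: the product `𝐖_{i,j₁} ⋯ 𝐖_{i,j_p}`. -/
def wordW (m : Fin k → ℕ) (i : Fin k) (α : FreeMonoid (Fin (n i))) :
    MultiFock n K →L[ℂ] MultiFock n K :=
  FreeMonoid.lift (fun j => W (K := K) (n := n) m i j) α

/-- `I_𝒦 ⊗ 𝐖_α`, where `𝐖_α = 𝐖_{1,α₁} ⋯ 𝐖_{k,α_k}`. -/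
def multiW (m : Fin k → ℕ) (α : MultiWord n) : MultiFock n K →L[ℂ] MultiFock n K :=
  (List.ofFn fun i => wordW (K := K) m i (α i)).prod

/-! ### Formal series and weighted multi-Toeplitz operators -/

/-- The term `A_{(α,β)} ⊗ 𝐖_α 𝐖_β^*` of the formal series. -/
def term (m : Fin k → ℕ) (A : J n → K →L[ℂ] K) (c : J n) : MultiFock n K →L[ℂ] MultiFock n K :=
  coeffOp n (A c) ∘L multiW m c.1.1 ∘L ContinuousLinearMap.adjoint (multiW m c.1.2)

/-- The homogeneous part `q_{s₁,…,s_k}(𝐖, 𝐖^*)`: the (finite) sum of the terms with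
`|α i| = (s i)⁺` and `|β i| = (s i)⁻`. -/
def homPart (m : Fin k → ℕ) (A : J n → K →L[ℂ] K) (s : Fin k → ℤ) :
    MultiFock n K →L[ℂ] MultiFock n K :=
  ∑ c ∈ (finite_hasDegree (n := n) s).toFinset, term m A c

/-- The term `r^{|s₁| + ⋯ + |s_k|} q_{s₁,…,s_k}(𝐖, 𝐖^*)` of the series `φ(r𝐖, r𝐖^*)`. -/
def radialTerm (m : Fin k → ℕ) (A : J n → K →L[ℂ] K) (r : ℝ) (s : Fin k → ℤ) :
    MultiFock n K →L[ℂ] MultiFock n K :=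
  ((r ^ (∑ i, (s i).natAbs) : ℝ) : ℂ) • homPart m A s

/-- `φ(r𝐖, r𝐖^*)`, the sum in the operator norm of
`∑_s r^{|s₁| + ⋯ + |s_k|} q_{s₁,…,s_k}(𝐖, 𝐖^*)` (when this series converges). -/
def radialSum (m : Fin k → ℕ) (A : J n → K →L[ℂ] K) (r : ℝ) :
    MultiFock n K →L[ℂ] MultiFock n K :=
  ∑' s : Fin k → ℤ, radialTerm m A r s

/-- The series `φ(r𝐖, r𝐖^*) p = ∑_{(α,β) ∈ 𝒥} r^{|(α,β)|} (A_{(α,β)} ⊗ 𝐖_α 𝐖_β^*) p` converges and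
its sum is `v`. -/
def HasValueAt (m : Fin k → ℕ) (A : J n → K →L[ℂ] K) (r : ℝ) (p v : MultiFock n K) : Prop :=
  HasSum (fun c : J n => ((r ^ totalLength c.1 : ℝ) : ℂ) • term m A c p) v

/-- `T` is a weighted (right) multi-Toeplitz operator. -/
def IsWeightedMultiToeplitz (m : Fin k → ℕ) (T : MultiFock n K →L[ℂ] MultiFock n K) : Prop :=
  ∃ A : J n → K →L[ℂ] K, ∀ (ω γ : MultiWord n) (x y : K),
    (∀ h : Comparable ω γ, inner ℂ (basisTensor y ω) (T (basisTensor x γ)) =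
      (tau m ω γ : ℂ) * inner ℂ y (A (simplify ω γ h) x)) ∧
    (¬ Comparable ω γ → inner ℂ (basisTensor y ω) (T (basisTensor x γ)) = 0)

/-- The formal series `φ = ∑_{(α,β) ∈ 𝒥} A_{(α,β)} ⊗ 𝐖_α 𝐖_β^*` is the formal Fourier representation
of `T`: one has `T p = φ(𝐖, 𝐖^*) p` for all `p ∈ 𝒫_𝒦`. -/
def IsFourierRepresentation (m : Fin k → ℕ) (A : J n → K →L[ℂ] K)
    (T : MultiFock n K →L[ℂ] MultiFock n K) : Prop :=
  ∀ p ∈ polynomials n K, HasValueAt m A 1 p (T p)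

end Operators

end PolyHyperball

end

open PolyHyperball Set Filter Topology

noncomputable section

namespace PolyHyperball

/-! ### Words and weights -/

/-! Everything is read off from operator-valued matrices. The term indexed by $c=(\alpha,\beta)$
sends $x\otimes e_{\beta\delta}$ to a multiple of $A_cx\otimes e_{\alpha\delta}$ and kills the other
$x\otimes e_\gamma$. Comparable pairs are exactly the pairs $(\alpha\delta,\beta\delta)$ with
$c\in\mathcal J$, and $c$, $\delta$ are unique. So each entry of the formal series comes from at
most one term, and each term meets a given column at most once. Consequently
`IsFourierRepresentation` only says that $T$ has the prescribed entries
(`isFourierRepresentation_iff`), while $\varphi(r\mathbf W,r\mathbf W^*)$ has the same entries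
multiplied by $r^{|s|}$, where $s$ is the vector of length differences and $|s|=\sum_i|s_i|$.

Given $T$, both passing to $r^{|s|}$ and isolating one degree are Schur multipliers $\sum_l
b_l(\omega)a_l(\gamma)$ with $\sum_l a_l^2\le1$ and $\sum_l b_l^2\le1$, hence contractive by
Cauchy–Schwarz (`opNorm_le_of_schur`). This bounds the homogeneous parts and the radial means by
$\|T\|$.

Conversely, if the radial means are bounded, a weak limit along an ultrafilter as $r\to1$ has the
required entries (`exists_hasEntries_one`). Strong convergence holds on polynomials by dominated
convergence in $\ell^2$ and extends by density and the uniform bound; the norm formula follows. The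
weak operator series in (i) sums to $E^*E$, where $E$ is a column of $T$. -/

theorem rightGE_mul {a : Type*} (σ γ : FreeMonoid a) : RightGE (σ * γ) γ := ⟨σ, rfl⟩

theorem rightQuot_mul {a : Type*} (σ γ : FreeMonoid a) : rightQuot (σ * γ) γ = σ := by
  rw [rightQuot, dif_pos (rightGE_mul σ γ)]
  exact (mul_right_cancel (rightGE_mul σ γ).choose_spec).symm

theorem rightQuot_mul_self {a : Type*} (σ γ : FreeMonoid a) : rightQuot γ (σ * γ) = 1 := by
  by_cases h : RightGE γ (σ * γ)
  · rw [rightQuot, dif_pos h]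
    have e := congrArg FreeMonoid.length h.choose_spec
    rw [FreeMonoid.length_mul, FreeMonoid.length_mul] at e
    exact FreeMonoid.length_eq_zero.1 (by omega)
  · rw [rightQuot, dif_neg h]

theorem bCoeff_pos (m p : ℕ) : 0 < bCoeff m p := Nat.choose_pos (by omega)

/-- The weight `√(b_γ / b_{αγ})` for words `α`, `γ` of lengths `p`, `q`. -/
def wordWeight (m p q : ℕ) : ℝ := √((bCoeff m q : ℝ) / bCoeff m (p + q))

theorem wordWeight_zero (m q : ℕ) : wordWeight m 0 q = 1 := by
  have := bCoeff_pos m q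
  rw [wordWeight, zero_add, div_self (by positivity), Real.sqrt_one]

/-- The ratios of the $b$'s telescope, so adding one letter on the left only lengthens the word in
the weight. -/
theorem dWeight_mul_wordWeight (m p q : ℕ) :
    dWeight m (p + q) * wordWeight m p q = wordWeight m (1 + p) q := by
  have h1 := bCoeff_pos m (p + q)
  have h2 := bCoeff_pos m q
  have h3 := bCoeff_pos m (p + q + 1)
  rw [dWeight, wordWeight, wordWeight, ← Real.sqrt_mul (by positivity),
    show 1 + p + q = p + q + 1 by ring]
  congr 1
  field_simp

section Words

variable {k : ℕ} {n : Fin k → ℕ}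

/-- One of $s_i^+$ and $s_i^-$ is zero. This dichotomy drives all the coordinatewise arguments about
$\mathcal J$. -/
theorem left_or_right_eq_one (c : J n) (i : Fin k) : c.1.1 i = 1 ∨ c.1.2 i = 1 := by
  obtain ⟨s, hs⟩ := c.2
  have h := hs i
  rcases le_total (s i) 0 with h0 | h0
  · left
    rw [posPart_of_nonpos h0] at h
    exact FreeMonoid.length_eq_zero.1 (by exact_mod_cast h.1)
  · right
    rw [negPart_of_nonneg h0] at h
    exact FreeMonoid.length_eq_zero.1 (by exact_mod_cast h.2)

theorem comparable_mul (c : J n) (δ : MultiWord n) : Comparable (c.1.1 * δ) (c.1.2 * δ) := by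
  intro i
  rcases left_or_right_eq_one c i with h | h
  · right; exact ⟨c.1.2 i, by simp [h]⟩
  · left; exact ⟨c.1.1 i, by simp [h]⟩

theorem simplify_mul (c : J n) (δ : MultiWord n) :
    simplify (c.1.1 * δ) (c.1.2 * δ) (comparable_mul c δ) = c := by
  apply Subtype.ext
  refine Prod.ext (funext fun i => ?_) (funext fun i => ?_)
  · rcases left_or_right_eq_one c i with h | h
    · simp [simplify, h, rightQuot_mul_self]
    · simp [simplify, h, rightQuot_mul]
  · rcases left_or_right_eq_one c i with h | h
    · simp [simplify, h, rightQuot_mul]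
    · simp [simplify, h, rightQuot_mul_self]

/-- The common factor $\delta_i$ is the shorter of the two words. With `simplify_mul` this
parametrizes the comparable pairs by $\mathcal J$ and a free multi-word $\delta$. -/
theorem Comparable.exists_eq_mul {ω γ : MultiWord n} (h : Comparable ω γ) :
    ∃ δ, ω = (simplify ω γ h).1.1 * δ ∧ γ = (simplify ω γ h).1.2 * δ := by
  have key : ∀ i, ∃ δ, ω i = rightQuot (ω i) (γ i) * δ ∧ γ i = rightQuot (γ i) (ω i) * δ := by
    intro i
    rcases h i with ⟨σ, hσ⟩ | ⟨σ, hσ⟩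
    · exact ⟨γ i, by rw [hσ, rightQuot_mul], by rw [hσ, rightQuot_mul_self, one_mul]⟩
    · exact ⟨ω i, by rw [hσ, rightQuot_mul_self, one_mul], by rw [hσ, rightQuot_mul]⟩
  choose δ h1 h2 using key
  exact ⟨δ, funext h1, funext h2⟩

/-- Since $\gamma=\beta\delta$, left cancellation recovers $\delta$ and then $\omega=\alpha\delta$.
Hence distinct terms of the series send $x\otimes e_\gamma$ to orthogonal vectors. -/
theorem simplify_left_injective {ω ω' γ : MultiWord n} (h : Comparable ω γ)
    (h' : Comparable ω' γ) (e : simplify ω γ h = simplify ω' γ h') : ω = ω' := by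
  obtain ⟨δ, h1, h2⟩ := h.exists_eq_mul
  obtain ⟨δ', h1', h2'⟩ := h'.exists_eq_mul
  rw [← e] at h1' h2'
  have : δ = δ' := mul_left_cancel (h2.symm.trans h2')
  rw [h1, h1', this]

theorem hasDegree_simplify_iff {ω γ : MultiWord n} (h : Comparable ω γ) (s : Fin k → ℤ) :
    HasDegree s (simplify ω γ h).1 ↔ ∀ i, ((ω i).length : ℤ) - (γ i).length = s i := by
  obtain ⟨δ, h1, h2⟩ := h.exists_eq_mul
  generalize simplify ω γ h = c at h1 h2
  subst h1 h2
  refine forall_congr' fun i => ?_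
  simp only [Pi.mul_apply, FreeMonoid.length_mul, posPart_def, negPart_def]
  rcases left_or_right_eq_one c i with h | h <;> rw [h, FreeMonoid.length_one] <;> omega

theorem totalLength_simplify {ω γ : MultiWord n} (h : Comparable ω γ) :
    totalLength (simplify ω γ h).1 = ∑ i, (((ω i).length : ℤ) - (γ i).length).natAbs := by
  obtain ⟨δ, h1, h2⟩ := h.exists_eq_mul
  generalize simplify ω γ h = c at h1 h2
  subst h1 h2
  refine Finset.sum_congr rfl fun i _ => ?_
  simp only [Pi.mul_apply, FreeMonoid.length_mul]
  rcases left_or_right_eq_one c i with h | h <;> rw [h, FreeMonoid.length_one] <;> omega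

/-- The weight of `𝐖_α` at `e_γ`. -/
def multiWeight (m : Fin k → ℕ) (α γ : MultiWord n) : ℝ :=
  ∏ i, wordWeight (m i) (α i).length (γ i).length

/-- In each coordinate one of the two weights is $1$, and the other compares the shorter word
$\delta_i$ with the longer one. -/
theorem multiWeight_mul_multiWeight (m : Fin k → ℕ) (c : J n) (δ : MultiWord n) :
    multiWeight m c.1.1 δ * multiWeight m c.1.2 δ = tau m (c.1.1 * δ) (c.1.2 * δ) := by
  rw [multiWeight, multiWeight, tau, ← Finset.prod_mul_distrib]
  refine Finset.prod_congr rfl fun i _ => ?_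
  simp only [Pi.mul_apply, FreeMonoid.length_mul]
  rcases left_or_right_eq_one c i with h | h
  · rw [h, FreeMonoid.length_one, wordWeight_zero, one_mul, zero_add, min_eq_left (by omega),
      max_eq_right (by omega), wordWeight]
  · rw [h, FreeMonoid.length_one, wordWeight_zero, mul_one, zero_add, min_eq_right (by omega),
      max_eq_left (by omega), wordWeight]

end Words

/-! ### Action of the weighted creation operators on elementary tensors -/

section Operators

variable {k : ℕ} {n : Fin k → ℕ} {K : Type*} [NormedAddCommGroup K]

theorem basisTensor_apply (x : K) (γ ω : MultiWord n) :
    (basisTensor x γ : MultiFock n K) ω = open Classical in if ω = γ then x else 0 := by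
  classical
  unfold basisTensor
  rw [lp.single_apply, Pi.single_apply]

theorem hasSum_basisTensor (f : MultiFock n K) : HasSum (fun γ => basisTensor (f γ) γ) f := by
  classical
  exact lp.hasSum_single (E := fun _ : MultiWord n => K) (p := 2) (by norm_num) f

variable [InnerProductSpace ℂ K]

theorem basisTensor_smul (a : ℂ) (x : K) (γ : MultiWord n) :
    (basisTensor (a • x) γ : MultiFock n K) = a • basisTensor x γ :=
  map_smul (basisTensorIsometry γ) a x

theorem basisTensor_zero (γ : MultiWord n) : (basisTensor 0 γ : MultiFock n K) = 0 :=
  map_zero (basisTensorIsometry γ)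

theorem inner_basisTensor_left (y : K) (ω : MultiWord n) (f : MultiFock n K) :
    inner ℂ (basisTensor y ω) f = inner ℂ y (f ω) := by
  classical
  exact lp.inner_single_left (𝕜 := ℂ) (G := fun _ : MultiWord n => K) ω y f

theorem entrywise_basisTensor (B : MultiWord n → K →L[ℂ] K) (C : ℝ) (hC : 0 ≤ C)
    (hB : ∀ γ, ‖B γ‖ ≤ C) (x : K) (γ : MultiWord n) :
    entrywise B C hC hB (basisTensor x γ) = basisTensor (B γ x) γ := by
  ext ω
  change B ω ((basisTensor x γ : MultiFock n K) ω) = _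
  rw [basisTensor_apply, basisTensor_apply]
  split_ifs with h
  · rw [h]
  · rw [map_zero]

theorem coeffOp_basisTensor (A : K →L[ℂ] K) (x : K) (γ : MultiWord n) :
    coeffOp n A (basisTensor x γ) = basisTensor (A x) γ :=
  entrywise_basisTensor _ _ _ _ x γ

theorem diagOp_basisTensor (m : Fin k → ℕ) (i : Fin k) (x : K) (γ : MultiWord n) :
    diagOp m i (basisTensor x γ) = ((dWeight (m i) (γ i).length : ℝ) : ℂ) • basisTensor x γ := by
  rw [diagOp, entrywise_basisTensor, ← basisTensor_smul]
  rfl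

variable [CompleteSpace K]

theorem leftCreation_basisTensor (i : Fin k) (j : Fin (n i)) (x : K) (γ : MultiWord n) :
    leftCreation i j (basisTensor x γ) = basisTensor x (consAt i j γ) := by
  classical
  unfold leftCreation
  exact OrthogonalFamily.linearIsometry_apply_single (𝕜 := ℂ) (G := fun _ : MultiWord n => K)
    (V := fun γ => basisTensorIsometry (consAt i j γ))
    (fun _ _ h x y => inner_basisTensor_consAt i j h x y) (i := γ) x

theorem W_basisTensor (m : Fin k → ℕ) (i : Fin k) (j : Fin (n i)) (x : K) (γ : MultiWord n) :
    W m i j (basisTensor x γ) =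
      ((dWeight (m i) (γ i).length : ℝ) : ℂ) • basisTensor x (consAt i j γ) := by
  rw [W, ContinuousLinearMap.comp_apply, diagOp_basisTensor, map_smul, leftCreation_basisTensor]

theorem wordW_basisTensor (m : Fin k → ℕ) (i : Fin k) (α : FreeMonoid (Fin (n i))) (x : K)
    (γ : MultiWord n) :
    wordW m i α (basisTensor x γ) =
      ((wordWeight (m i) α.length (γ i).length : ℝ) : ℂ) •
        basisTensor x (Function.update γ i (α * γ i)) := by
  induction α using FreeMonoid.recOn with
  | one => simp [wordW, wordWeight_zero]
  | of_mul j α ih =>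
    have h : wordW (K := K) m i (FreeMonoid.of j * α) = W m i j ∘L wordW m i α := by
      rw [wordW, map_mul, FreeMonoid.lift_eval_of]; rfl
    rw [h, ContinuousLinearMap.comp_apply, ih, map_smul, W_basisTensor, smul_smul,
      FreeMonoid.length_mul, FreeMonoid.length_of, ← dWeight_mul_wordWeight, Function.update_self,
      FreeMonoid.length_mul]
    congr 1
    · push_cast; ring
    · rw [consAt, Function.update_idem, Function.update_self, mul_assoc]

theorem multiW_basisTensor (m : Fin k → ℕ) (α : MultiWord n) (x : K) (γ : MultiWord n) :
    multiW m α (basisTensor x γ) = ((multiWeight m α γ : ℝ) : ℂ) • basisTensor x (α * γ) := by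
  -- Because the list has no repetitions, each factor meets a coordinate untouched by the factors to
  -- its right, so its weight still involves the original $\gamma_i$.
  have key : ∀ l : List (Fin k), l.Nodup →
      ((l.map fun i => wordW (K := K) m i (α i)).prod) (basisTensor x γ) =
        (((l.map fun i => wordWeight (m i) (α i).length (γ i).length).prod : ℝ) : ℂ) •
          basisTensor x (fun i => if i ∈ l then α i * γ i else γ i) := by
    intro l
    induction l with
    | nil => intro _; simp
    | cons i l ih =>
      intro h
      rw [List.nodup_cons] at h
      rw [List.map_cons, List.prod_cons, mul_apply_eq_comp, ih h.2, map_smul,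
        wordW_basisTensor, smul_smul, List.map_cons, List.prod_cons, if_neg h.1]
      congr 1
      · push_cast; ring
      · congr 1
        funext j
        by_cases hj : j = i
        · subst hj; simp
        · simp [hj]
  have h := key (List.finRange k) (List.nodup_finRange k)
  rw [multiW, List.ofFn_eq_map, h, multiWeight, ← List.ofFn_eq_map, List.prod_ofFn]
  congr 2
  funext i
  simp

theorem adjoint_multiW_basisTensor_apply (m : Fin k → ℕ) (β : MultiWord n) (x : K)
    (γ δ : MultiWord n) :
    (ContinuousLinearMap.adjoint (multiW m β) (basisTensor x γ) : MultiFock n K) δ =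
      open Classical in if β * δ = γ then ((multiWeight m β δ : ℝ) : ℂ) • x else 0 := by
  refine ext_inner_left ℂ fun y => ?_
  rw [← inner_basisTensor_left, ContinuousLinearMap.adjoint_inner_right, multiW_basisTensor,
    inner_smul_left, inner_basisTensor, Complex.conj_ofReal]
  split_ifs with h
  · rw [inner_smul_right]
  · rw [mul_zero, inner_zero_right]

theorem adjoint_multiW_basisTensor_mul (m : Fin k → ℕ) (β : MultiWord n) (x : K)
    (δ : MultiWord n) :
    ContinuousLinearMap.adjoint (multiW m β) (basisTensor x (β * δ)) =
      ((multiWeight m β δ : ℝ) : ℂ) • (basisTensor x δ : MultiFock n K) := by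
  ext ω
  rw [adjoint_multiW_basisTensor_apply, ← basisTensor_smul, basisTensor_apply]
  by_cases h : ω = δ
  · rw [if_pos (by rw [h]), if_pos h, h]
  · rw [if_neg fun e => h (mul_left_cancel e), if_neg h]

theorem adjoint_multiW_basisTensor_eq_zero (m : Fin k → ℕ) (β : MultiWord n) (x : K)
    {γ : MultiWord n} (h : ∀ δ, γ ≠ β * δ) :
    ContinuousLinearMap.adjoint (multiW m β) (basisTensor x γ : MultiFock n K) = 0 := by
  ext ω
  rw [adjoint_multiW_basisTensor_apply, if_neg fun e => h ω e.symm]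
  rfl

theorem term_basisTensor_mul (m : Fin k → ℕ) (A : J n → K →L[ℂ] K) (c : J n) (x : K)
    (δ : MultiWord n) :
    term m A c (basisTensor x (c.1.2 * δ)) =
      basisTensor (((tau m (c.1.1 * δ) (c.1.2 * δ) : ℝ) : ℂ) • A c x) (c.1.1 * δ) := by
  rw [term, ContinuousLinearMap.comp_apply, ContinuousLinearMap.comp_apply,
    adjoint_multiW_basisTensor_mul, map_smul, map_smul, multiW_basisTensor, map_smul,
    coeffOp_basisTensor, smul_smul, basisTensor_smul, ← multiWeight_mul_multiWeight]
  push_cast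
  rw [mul_comm]

theorem term_basisTensor_simplify (m : Fin k → ℕ) (A : J n → K →L[ℂ] K) {ω γ : MultiWord n}
    (h : Comparable ω γ) (x : K) :
    term m A (simplify ω γ h) (basisTensor x γ) =
      basisTensor (((tau m ω γ : ℝ) : ℂ) • A (simplify ω γ h) x) ω := by
  obtain ⟨δ, h1, h2⟩ := h.exists_eq_mul
  have := term_basisTensor_mul m A (simplify ω γ h) x δ
  rwa [← h1, ← h2] at this

theorem term_basisTensor_eq_zero (m : Fin k → ℕ) (A : J n → K →L[ℂ] K) (c : J n)
    {γ : MultiWord n} (h : ∀ ω, ∀ hω : Comparable ω γ, simplify ω γ hω ≠ c) (x : K) :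
    term m A c (basisTensor x γ) = 0 := by
  rw [term, ContinuousLinearMap.comp_apply, ContinuousLinearMap.comp_apply,
    adjoint_multiW_basisTensor_eq_zero, map_zero, map_zero]
  rintro δ rfl
  exact h _ (comparable_mul c δ) (simplify_mul c δ)

/-- The `(ω, γ)` entry of `A_c ⊗ 𝐖_α 𝐖_β^*`. -/
theorem term_basisTensor_apply (m : Fin k → ℕ) (A : J n → K →L[ℂ] K) (c : J n)
    (ω γ : MultiWord n) (x : K) :
    (term m A c (basisTensor x γ) : MultiFock n K) ω = open Classical in
      if ∃ h : Comparable ω γ, simplify ω γ h = c then ((tau m ω γ : ℝ) : ℂ) • A c x else 0 := by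
  by_cases h : ∃ ω', ∃ h : Comparable ω' γ, simplify ω' γ h = c
  · obtain ⟨ω', h', rfl⟩ := h
    rw [term_basisTensor_simplify, basisTensor_apply]
    by_cases e : ω = ω'
    · subst e
      rw [if_pos rfl, if_pos ⟨h', rfl⟩]
    · rw [if_neg e, if_neg]
      rintro ⟨h, h2⟩
      exact e (simplify_left_injective h h' h2)
  · push Not at h
    rw [term_basisTensor_eq_zero m A c h, if_neg]
    · rfl
    · rintro ⟨h', h2⟩
      exact h ω h' h2

end Operators

/-! ### Matrix entries -/

section Entries

variable {k : ℕ} {n : Fin k → ℕ} {K : Type*} [NormedAddCommGroup K] [InnerProductSpace ℂ K]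

/-- The `(ω, γ)` entry of the formal series with coefficients `A`. -/
def entry (m : Fin k → ℕ) (A : J n → K →L[ℂ] K) (ω γ : MultiWord n) : K →L[ℂ] K :=
  open Classical in
    if h : Comparable ω γ then ((tau m ω γ : ℝ) : ℂ) • A (simplify ω γ h) else 0

theorem entry_of_comparable (m : Fin k → ℕ) (A : J n → K →L[ℂ] K) {ω γ : MultiWord n}
    (h : Comparable ω γ) : entry m A ω γ = ((tau m ω γ : ℝ) : ℂ) • A (simplify ω γ h) :=
  dif_pos h

/-- The degree of the `(ω, γ)` entry. -/
def degree (ω γ : MultiWord n) (i : Fin k) : ℤ := ((ω i).length : ℤ) - (γ i).length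

/-- The operator `Φ` has the matrix entries of the formal series with coefficients `A`, multiplied
by the scalars `w (ω, γ)`. -/
def HasEntries (m : Fin k → ℕ) (A : J n → K →L[ℂ] K) (w : MultiWord n → MultiWord n → ℝ)
    (Φ : MultiFock n K →L[ℂ] MultiFock n K) : Prop :=
  ∀ (ω γ : MultiWord n) (x : K),
    (Φ (basisTensor x γ) : MultiFock n K) ω = ((w ω γ : ℝ) : ℂ) • entry m A ω γ x

/-- The scalar `r^{|s₁| + ⋯ + |s_k|}`, where `s` is the degree of `(ω, γ)`. -/
def radialWeight (r : ℝ) (ω γ : MultiWord n) : ℝ := r ^ ∑ i, (degree ω γ i).natAbs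

theorem radialWeight_one (ω γ : MultiWord n) : radialWeight 1 ω γ = 1 := one_pow _

theorem basisTensor_mem_polynomials (x : K) (γ : MultiWord n) :
    (basisTensor x γ : MultiFock n K) ∈ polynomials n K :=
  Submodule.subset_span ⟨x, γ, rfl⟩

theorem HasEntries.isWeightedMultiToeplitz {m : Fin k → ℕ} {A : J n → K →L[ℂ] K}
    {T : MultiFock n K →L[ℂ] MultiFock n K} (h : HasEntries m A (radialWeight 1) T) :
    IsWeightedMultiToeplitz m T := by
  refine ⟨A, fun ω γ x y => ⟨fun hc => ?_, fun hc => ?_⟩⟩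
  · rw [inner_basisTensor_left, h, radialWeight_one, Complex.ofReal_one, one_smul, entry,
      dif_pos hc, _root_.smul_apply, inner_smul_right]
  · rw [inner_basisTensor_left, h, entry, dif_neg hc, _root_.zero_apply, smul_zero,
      inner_zero_right]

variable [CompleteSpace K]

theorem term_basisTensor_apply_of_ne (m : Fin k → ℕ) (A : J n → K →L[ℂ] K) {c : J n}
    {ω γ : MultiWord n} (h : ∀ h : Comparable ω γ, simplify ω γ h ≠ c) (x : K) :
    (term m A c (basisTensor x γ) : MultiFock n K) ω = 0 := by
  rw [term_basisTensor_apply, if_neg]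
  rintro ⟨h1, h2⟩
  exact h h1 h2

theorem term_simplify_basisTensor_apply (m : Fin k → ℕ) (A : J n → K →L[ℂ] K)
    {ω γ : MultiWord n} (h : Comparable ω γ) (x : K) :
    (term m A (simplify ω γ h) (basisTensor x γ) : MultiFock n K) ω = entry m A ω γ x := by
  rw [term_basisTensor_apply, if_pos ⟨h, rfl⟩, entry, dif_pos h]
  rfl

/-- Only the term at `simplify ω γ` can contribute to the $(\omega,\gamma)$ entry, and it occurs in
the sum exactly when the length differences equal $s$. -/
theorem homPart_hasEntries (m : Fin k → ℕ) (A : J n → K →L[ℂ] K) (s : Fin k → ℤ) :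
    HasEntries m A (fun ω γ => if degree ω γ = s then 1 else 0) (homPart m A s) := by
  intro ω γ x
  have e : (homPart m A s (basisTensor x γ) : MultiFock n K) ω =
      ∑ c ∈ (finite_hasDegree (n := n) s).toFinset,
        (term m A c (basisTensor x γ) : MultiFock n K) ω := by
    rw [homPart, _root_.sum_apply, lp.coeFn_sum, Finset.sum_apply]
  rw [e]
  by_cases h : Comparable ω γ
  · have hd : simplify ω γ h ∈ (finite_hasDegree (n := n) s).toFinset ↔ degree ω γ = s := by
      rw [Set.Finite.mem_toFinset, Set.mem_ofPred_eq, hasDegree_simplify_iff, funext_iff]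
      rfl
    dsimp only
    split_ifs with hs
    · rw [Finset.sum_eq_single_of_mem _ (hd.2 hs)
        fun c _ hc => term_basisTensor_apply_of_ne m A (fun _ => hc.symm) x,
        term_simplify_basisTensor_apply, Complex.ofReal_one, one_smul]
    · rw [Complex.ofReal_zero, zero_smul]
      refine Finset.sum_eq_zero fun c hc => term_basisTensor_apply_of_ne m A (fun _ e => ?_) x
      rw [← e] at hc
      exact hs (hd.1 hc)
  · rw [entry, dif_neg h, _root_.zero_apply, smul_zero]
    exact Finset.sum_eq_zero fun c hc =>
      term_basisTensor_apply_of_ne m A (fun h' => absurd h' h) x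

theorem radialSum_hasEntries (m : Fin k → ℕ) (A : J n → K →L[ℂ] K) {r : ℝ}
    (hr : Summable (radialTerm m A r)) : HasEntries m A (radialWeight r) (radialSum m A r) := by
  intro ω γ x
  have h1 : HasSum (fun s => (radialTerm m A r s (basisTensor x γ) : MultiFock n K) ω)
      ((radialSum m A r (basisTensor x γ) : MultiFock n K) ω) :=
    (hr.hasSum.mapL (ContinuousLinearMap.apply ℂ (MultiFock n K) (basisTensor x γ))).mapL
      (lp.evalCLM ℂ (fun _ : MultiWord n => K) 2 ω)
  have h2 : ∀ s, (radialTerm m A r s (basisTensor x γ) : MultiFock n K) ω =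
      if s = degree ω γ then ((radialWeight r ω γ : ℝ) : ℂ) • entry m A ω γ x else 0 := by
    intro s
    change ((r ^ (∑ i, (s i).natAbs) : ℝ) : ℂ) •
      (homPart m A s (basisTensor x γ) : MultiFock n K) ω = _
    rw [homPart_hasEntries]
    dsimp only
    by_cases hs : s = degree ω γ
    · subst hs
      rw [if_pos rfl, if_pos rfl, Complex.ofReal_one, one_smul]
      rfl
    · rw [if_neg hs, if_neg (Ne.symm hs), Complex.ofReal_zero, zero_smul, smul_zero]
  simp_rw [h2] at h1
  exact h1.unique (hasSum_ite_eq _ _)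

/-- The nonzero terms of the series at $x\otimes e_\gamma$ lie in distinct summands $\mathcal
K\otimes e_\omega$. Convergence to $v$ is therefore the orthogonal expansion of $v$, reindexed from
the words $\omega$ to $\mathcal J$. -/
theorem hasValueAt_basisTensor_iff (m : Fin k → ℕ) (A : J n → K →L[ℂ] K) (r : ℝ) (x : K)
    (γ : MultiWord n) (v : MultiFock n K) :
    HasValueAt m A r (basisTensor x γ) v ↔
      ∀ ω, v ω = ((radialWeight r ω γ : ℝ) : ℂ) • entry m A ω γ x := by
  have hw : ∀ ω, ∀ h : Comparable ω γ,
      r ^ totalLength (simplify ω γ h).1 = radialWeight r ω γ := by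
    intro ω h
    rw [totalLength_simplify]
    rfl
  constructor
  · intro h ω
    have h1 : HasSum (fun c : J n => (((r ^ totalLength c.1 : ℝ) : ℂ) •
        (term m A c (basisTensor x γ) : MultiFock n K) ω)) (v ω) :=
      h.mapL (lp.evalCLM ℂ (fun _ : MultiWord n => K) 2 ω)
    by_cases hc : Comparable ω γ
    · refine h1.unique ?_
      have h2 := hasSum_single (f := fun c : J n => (((r ^ totalLength c.1 : ℝ) : ℂ) •
        (term m A c (basisTensor x γ) : MultiFock n K) ω)) (simplify ω γ hc) fun c hne => by
          dsimp only
          rw [term_basisTensor_apply_of_ne m A (fun _ => hne.symm), smul_zero]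
      rwa [term_simplify_basisTensor_apply, hw] at h2
    · rw [entry, dif_neg hc, _root_.zero_apply, smul_zero]
      refine h1.unique ?_
      have h2 : (fun c : J n => (((r ^ totalLength c.1 : ℝ) : ℂ) •
          (term m A c (basisTensor x γ) : MultiFock n K) ω)) = fun _ => 0 := by
        funext c
        rw [term_basisTensor_apply_of_ne m A (fun h' => absurd h' hc), smul_zero]
      rw [h2]
      exact hasSum_zero
  · intro h
    have h0 := hasSum_basisTensor v
    have h1 : HasSum (fun ω : {ω // Comparable ω γ} => basisTensor (v ω.1) ω.1) v := by
      refine (hasSum_subtype_iff_of_support_subset (s := {ω | Comparable ω γ})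
        (f := fun ω => (basisTensor (v ω) ω : MultiFock n K)) fun ω hω => ?_).2 h0
      by_contra hc
      refine hω ?_
      dsimp only
      rw [h, entry, dif_neg (show ¬Comparable ω γ from hc), _root_.zero_apply, smul_zero, basisTensor_zero]
    have hinj : Function.Injective
        fun ω : {ω : MultiWord n // Comparable ω γ} => simplify ω.1 γ ω.2 := fun ω ω' e =>
      Subtype.ext (simplify_left_injective ω.2 ω'.2 e)
    refine (hinj.hasSum_iff fun c hc => ?_).1 ?_
    · rw [term_basisTensor_eq_zero m A c, smul_zero]
      intro ω hω e
      exact hc ⟨⟨ω, hω⟩, e⟩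
    · refine h1.congr_fun fun ω => ?_
      dsimp only [Function.comp]
      rw [term_basisTensor_simplify, hw, h, entry, dif_pos ω.2, basisTensor_smul, basisTensor_smul,
        _root_.smul_apply, basisTensor_smul]

theorem HasEntries.hasValueAt {m : Fin k → ℕ} {A : J n → K →L[ℂ] K} {r : ℝ}
    {Φ : MultiFock n K →L[ℂ] MultiFock n K} (h : HasEntries m A (radialWeight r) Φ)
    {p : MultiFock n K} (hp : p ∈ polynomials n K) : HasValueAt m A r p (Φ p) := by
  induction hp using Submodule.span_induction with
  | mem v hv =>
    obtain ⟨x, γ, rfl⟩ := hv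
    exact (hasValueAt_basisTensor_iff m A r x γ _).2 fun ω => h ω γ x
  | zero =>
    simp only [HasValueAt, map_zero, smul_zero]
    exact hasSum_zero
  | add v w _ _ hv hw =>
    simp only [HasValueAt, map_add, smul_add] at hv hw ⊢
    exact hv.add hw
  | smul a v _ hv =>
    simp only [HasValueAt, map_smul] at hv ⊢
    have := hv.const_smul a
    simpa only [smul_comm a] using this

theorem hasEntries_of_hasValueAt {m : Fin k → ℕ} {A : J n → K →L[ℂ] K} {r : ℝ}
    {Φ : MultiFock n K →L[ℂ] MultiFock n K}
    (h : ∀ p ∈ polynomials n K, HasValueAt m A r p (Φ p)) : HasEntries m A (radialWeight r) Φ :=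
  fun ω γ x => (hasValueAt_basisTensor_iff m A r x γ _).1 (h _ (basisTensor_mem_polynomials x γ)) ω

theorem isFourierRepresentation_iff {m : Fin k → ℕ} {A : J n → K →L[ℂ] K}
    {T : MultiFock n K →L[ℂ] MultiFock n K} :
    IsFourierRepresentation m A T ↔ HasEntries m A (radialWeight 1) T :=
  ⟨hasEntries_of_hasValueAt, fun h _ hp => h.hasValueAt hp⟩

end Entries

/-! ### Bounded families of operators and Schur multipliers -/

section Limits

variable {H : Type*} [NormedAddCommGroup H] [InnerProductSpace ℂ H]

theorem opNorm_le_of_inner_le (Φ : H →L[ℂ] H) {C : ℝ} (hC : 0 ≤ C)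
    (h : ∀ f g, ‖(inner ℂ g (Φ f) : ℂ)‖ ≤ C * ‖f‖ * ‖g‖) : ‖Φ‖ ≤ C := by
  refine Φ.opNorm_le_bound hC fun f => ?_
  rcases eq_or_lt_of_le (norm_nonneg (Φ f)) with h0 | h0
  · rw [← h0]; positivity
  · have := h f (Φ f)
    rw [inner_self_eq_norm_sq_to_K] at this
    have e : ‖((‖Φ f‖ : ℂ)) ^ 2‖ = ‖Φ f‖ * ‖Φ f‖ := by
      rw [norm_pow, Complex.norm_real, norm_norm, sq]
    exact le_of_mul_le_mul_right (e ▸ this) h0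

variable [CompleteSpace H]

/-- A bounded family of operators has a limit in the weak operator topology along an
ultrafilter. -/
theorem exists_ultrafilter_tendsto_inner {ι : Type*} (U : Ultrafilter ι) (Φ : ι → H →L[ℂ] H)
    (C : ℝ) (hC : ∀ᶠ i in U, ‖Φ i‖ ≤ C) :
    ∃ T : H →L[ℂ] H, ∀ v w : H,
      Tendsto (fun i => (inner ℂ (Φ i v) w : ℂ)) U (𝓝 (inner ℂ (T v) w)) := by
  have key : ∀ v w : H, ∃ z : ℂ, ‖z‖ ≤ C * ‖v‖ * ‖w‖ ∧
      Tendsto (fun i => (inner ℂ (Φ i v) w : ℂ)) U (𝓝 z) := by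
    intro v w
    -- The matrix coefficients eventually lie in a fixed compact disc, where every ultrafilter
    -- converges; the disc's radius also bounds the limiting sesquilinear form.
    obtain ⟨z, hz, hz2⟩ := (isCompact_closedBall (0 : ℂ) (C * ‖v‖ * ‖w‖)).ultrafilter_le_nhds
      (U.map fun i => (inner ℂ (Φ i v) w : ℂ)) (by
        rw [le_principal_iff, Ultrafilter.coe_map, mem_map]
        filter_upwards [hC] with i hi
        rw [mem_preimage, mem_closedBall_zero_iff]
        refine (norm_inner_le_norm _ _).trans ?_
        gcongr
        exact (Φ i).le_of_opNorm_le hi v)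
    exact ⟨z, mem_closedBall_zero_iff.1 hz, hz2⟩
  choose B hB hlim using key
  let B' : H →ₗ⋆[ℂ] H →ₗ[ℂ] ℂ := LinearMap.mk₂'ₛₗ (starRingEnd ℂ) (RingHom.id ℂ) B
    (fun v v' w => tendsto_nhds_unique (hlim _ _) (by
      simpa only [map_add, inner_add_left] using (hlim v w).add (hlim v' w)))
    (fun a v w => tendsto_nhds_unique (hlim _ _) (by
      simpa only [map_smul, inner_smul_left, smul_eq_mul] using (hlim v w).const_mul _))
    (fun v w w' => tendsto_nhds_unique (hlim _ _) (by
      simpa only [inner_add_right] using (hlim v w).add (hlim v w')))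
    (fun a v w => tendsto_nhds_unique (hlim _ _) (by
      simpa only [inner_smul_right, smul_eq_mul, RingHom.id_apply] using (hlim v w).const_mul _))
  let B'' : H →L⋆[ℂ] H →L[ℂ] ℂ := LinearMap.mkContinuous₂ B' C hB
  refine ⟨InnerProductSpace.continuousLinearMapOfBilin B'', fun v w => ?_⟩
  rw [InnerProductSpace.continuousLinearMapOfBilin_apply]
  exact hlim v w

end Limits

/-! ### Schur multipliers -/

section Schur

variable {k : ℕ} {n : Fin k → ℕ} {K : Type*} [NormedAddCommGroup K]

theorem sum_norm_sq_le (F : Finset (MultiWord n)) (f : MultiFock n K) :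
    ∑ γ ∈ F, ‖f γ‖ ^ 2 ≤ ‖f‖ ^ 2 := by
  have := lp.sum_rpow_le_norm_rpow (E := fun _ : MultiWord n => K) (p := 2) (by norm_num) f F
  simpa using this

theorem norm_sq_sum_basisTensor (F : Finset (MultiWord n)) (f : MultiWord n → K) :
    ‖(∑ γ ∈ F, basisTensor (f γ) γ : MultiFock n K)‖ ^ 2 = ∑ γ ∈ F, ‖f γ‖ ^ 2 := by
  classical
  have := lp.norm_sum_single (E := fun _ : MultiWord n => K) (p := 2) (by norm_num) f F
  simpa [basisTensor] using this

variable [InnerProductSpace ℂ K]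

/-- The finitely supported vector `∑_{γ ∈ F} a_γ f_γ ⊗ e_γ`. -/
def truncation (F : Finset (MultiWord n)) (a : MultiWord n → ℝ)
    (f : MultiFock n K) : MultiFock n K := ∑ γ ∈ F, basisTensor (((a γ : ℝ) : ℂ) • f γ) γ

theorem norm_sq_truncation (F : Finset (MultiWord n)) (a : MultiWord n → ℝ)
    (f : MultiFock n K) : ‖truncation F a f‖ ^ 2 = ∑ γ ∈ F, a γ ^ 2 * ‖f γ‖ ^ 2 := by
  rw [truncation, norm_sq_sum_basisTensor]
  refine Finset.sum_congr rfl fun γ _ => ?_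
  rw [norm_smul, Complex.norm_real, mul_pow, Real.norm_eq_abs, sq_abs]

theorem sum_norm_sq_truncation_le {ι : Type*} (L : Finset ι) (F : Finset (MultiWord n))
    (a : ι → MultiWord n → ℝ) (ha : ∀ γ ∈ F, ∑ l ∈ L, a l γ ^ 2 ≤ 1) (f : MultiFock n K) :
    ∑ l ∈ L, ‖truncation F (a l) f‖ ^ 2 ≤ ‖f‖ ^ 2 := by
  simp_rw [norm_sq_truncation]
  rw [Finset.sum_comm]
  refine le_trans (Finset.sum_le_sum fun γ hγ => ?_) (sum_norm_sq_le F f)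
  rw [← Finset.sum_mul]
  exact mul_le_of_le_one_left (by positivity) (ha γ hγ)

theorem inner_truncation (T : MultiFock n K →L[ℂ] MultiFock n K) (F : Finset (MultiWord n))
    (a b : MultiWord n → ℝ) (f g : MultiFock n K) :
    (inner ℂ (truncation F b g) (T (truncation F a f)) : ℂ) =
      ∑ ω ∈ F, ∑ γ ∈ F, ((b ω * a γ : ℝ) : ℂ) *
        inner ℂ (g ω) ((T (basisTensor (f γ) γ) : MultiFock n K) ω) := by
  rw [truncation, truncation, map_sum, sum_inner]
  refine Finset.sum_congr rfl fun ω _ => ?_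
  rw [inner_sum]
  refine Finset.sum_congr rfl fun γ _ => ?_
  rw [basisTensor_smul, basisTensor_smul, map_smul, inner_smul_left, inner_smul_right,
    inner_basisTensor_left, Complex.conj_ofReal]
  push_cast
  ring

/-- A Schur multiplier of the form `∑_l b_l(ω) a_l(γ)` with `∑_l a_l² ≤ 1` and `∑_l b_l² ≤ 1` is
contractive. -/
theorem opNorm_le_of_schur {ι : Type*} (T Φ : MultiFock n K →L[ℂ] MultiFock n K)
    (w : MultiWord n → MultiWord n → ℝ)
    (hΦ : ∀ ω γ x, (Φ (basisTensor x γ) : MultiFock n K) ω =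
      ((w ω γ : ℝ) : ℂ) • (T (basisTensor x γ) : MultiFock n K) ω)
    (hw : ∀ F : Finset (MultiWord n), ∃ (L : Finset ι) (a b : ι → MultiWord n → ℝ),
      (∀ γ ∈ F, ∑ l ∈ L, a l γ ^ 2 ≤ 1) ∧ (∀ ω ∈ F, ∑ l ∈ L, b l ω ^ 2 ≤ 1) ∧
        ∀ ω ∈ F, ∀ γ ∈ F, w ω γ = ∑ l ∈ L, b l ω * a l γ) : ‖Φ‖ ≤ ‖T‖ := by
  refine opNorm_le_of_inner_le Φ (norm_nonneg T) fun f g => ?_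
  have hF : ∀ F : Finset (MultiWord n),
      ‖(inner ℂ (truncation F (fun _ => 1) g) (Φ (truncation F (fun _ => 1) f)) : ℂ)‖ ≤
        ‖T‖ * ‖f‖ * ‖g‖ := by
    intro F
    obtain ⟨L, a, b, ha, hb, hab⟩ := hw F
    -- The factorization moves the multiplier from the matrix of $T$ onto the vectors: $b_l$
    -- multiplies $g$ and $a_l$ multiplies $f$.
    have e : (inner ℂ (truncation F (fun _ => 1) g) (Φ (truncation F (fun _ => 1) f)) : ℂ) =
        ∑ l ∈ L, inner ℂ (truncation F (b l) g) (T (truncation F (a l) f)) := by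
      simp_rw [inner_truncation]
      symm
      rw [Finset.sum_comm]
      refine Finset.sum_congr rfl fun ω hω => ?_
      rw [Finset.sum_comm]
      refine Finset.sum_congr rfl fun γ hγ => ?_
      rw [← Finset.sum_mul, hΦ, inner_smul_right, hab ω hω γ hγ]
      push_cast
      ring
    rw [e]
    calc ‖∑ l ∈ L, (inner ℂ (truncation F (b l) g) (T (truncation F (a l) f)) : ℂ)‖
        ≤ ∑ l ∈ L, ‖T‖ * (‖truncation F (a l) f‖ * ‖truncation F (b l) g‖) := by
          refine (norm_sum_le _ _).trans (Finset.sum_le_sum fun l _ => ?_)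
          refine (norm_inner_le_norm _ _).trans ?_
          rw [mul_comm, ← mul_assoc]
          gcongr
          exact T.le_opNorm _
      _ = ‖T‖ * ∑ l ∈ L, ‖truncation F (a l) f‖ * ‖truncation F (b l) g‖ := by
          rw [Finset.mul_sum]
      _ ≤ ‖T‖ * (‖f‖ * ‖g‖) := by
          gcongr
          refine (Real.sum_mul_le_sqrt_mul_sqrt L _ _).trans ?_
          gcongr
          · exact Real.sqrt_le_iff.2 ⟨norm_nonneg _, sum_norm_sq_truncation_le L F a ha f⟩
          · exact Real.sqrt_le_iff.2 ⟨norm_nonneg _, sum_norm_sq_truncation_le L F b hb g⟩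
      _ = ‖T‖ * ‖f‖ * ‖g‖ := by ring
  have ht : ∀ f : MultiFock n K,
      Tendsto (fun F => truncation F (fun _ => 1) f) atTop (𝓝 f) := by
    intro f
    simp only [truncation, Complex.ofReal_one, one_smul]
    exact hasSum_basisTensor f
  exact le_of_tendsto' (((ht g).inner ((Φ.continuous.tendsto f).comp (ht f))).norm) hF

/-- The coefficients in `r^{|p - q|} = ∑_l a_l(p) a_l(q)`. -/
def poissonCoeff (r : ℝ) (l p : ℕ) : ℝ :=
  if l = 0 then r ^ p else if l ≤ p then √(1 - r ^ 2) * r ^ (p - l) else 0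

/-- A telescoping sum: with $d=q-p$, the terms up to $M\le p$ add up to $r^d r^{2(p-M)}$, and the
terms with $l>p$ vanish. This is an explicit Gram factorization of the kernel $r^{|p-q|}$. -/
theorem sum_poissonCoeff_mul {r : ℝ} (hr : r ^ 2 ≤ 1) {p q : ℕ} (hpq : p ≤ q) {N : ℕ}
    (hN : p ≤ N) :
    ∑ l ∈ Finset.range (N + 1), poissonCoeff r l p * poissonCoeff r l q = r ^ (q - p) := by
  obtain ⟨d, rfl⟩ := Nat.exists_eq_add_of_le hpq
  rw [Nat.add_sub_cancel_left]
  have hs : √(1 - r ^ 2) * √(1 - r ^ 2) = 1 - r ^ 2 := Real.mul_self_sqrt (by linarith)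
  have key : ∀ M ≤ p, ∑ l ∈ Finset.range (M + 1), poissonCoeff r l p * poissonCoeff r l (p + d) =
      r ^ d * (r ^ 2) ^ (p - M) := by
    intro M
    induction M with
    | zero =>
      intro _
      simp only [zero_add, Finset.sum_range_one, poissonCoeff, if_true, Nat.sub_zero]
      ring
    | succ M ih =>
      intro hM
      rw [Finset.sum_range_succ, ih (by omega)]
      obtain ⟨t, rfl⟩ := Nat.exists_eq_add_of_le hM
      rw [poissonCoeff, poissonCoeff, if_neg M.succ_ne_zero, if_neg M.succ_ne_zero, if_pos hM,
        if_pos (by omega), show M + 1 + t - (M + 1) = t by omega,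
        show M + 1 + t + d - (M + 1) = t + d by omega, show M + 1 + t - M = t + 1 by omega]
      linear_combination (r ^ t * r ^ (t + d)) * hs
  have h2 : ∑ l ∈ Finset.range (N + 1), poissonCoeff r l p * poissonCoeff r l (p + d) =
      ∑ l ∈ Finset.range (p + 1), poissonCoeff r l p * poissonCoeff r l (p + d) := by
    refine (Finset.sum_subset (Finset.range_subset_range.2 (by omega)) fun l _ hl => ?_).symm
    rw [Finset.mem_range, not_lt] at hl
    rw [poissonCoeff, if_neg (by omega), if_neg (by omega), zero_mul]
  rw [h2, key p le_rfl, Nat.sub_self, pow_zero, mul_one]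

theorem sum_poissonCoeff_mul_eq_pow_natAbs {r : ℝ} (hr : r ^ 2 ≤ 1) {p q N : ℕ} (hp : p ≤ N)
    (hq : q ≤ N) :
    ∑ l ∈ Finset.range (N + 1), poissonCoeff r l p * poissonCoeff r l q =
      r ^ ((p : ℤ) - q).natAbs := by
  rcases le_total p q with h | h
  · rw [sum_poissonCoeff_mul hr h hp]
    congr 1
    omega
  · simp_rw [mul_comm (poissonCoeff r _ p)]
    rw [sum_poissonCoeff_mul hr h hq]
    congr 1
    omega

end Schur

/-! ### Radial means -/

theorem summable_pow_natAbs {r : ℝ} (h0 : 0 ≤ r) (h1 : r < 1) :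
    Summable fun z : ℤ => r ^ z.natAbs := by
  refine Summable.of_nat_of_neg ?_ ?_ <;>
    simpa using summable_geometric_of_lt_one h0 h1

/-- Any finite set of indices lies in a box, over which the sum factors into $k$ one-dimensional
sums. -/
theorem summable_pow_sum_natAbs (k : ℕ) {r : ℝ} (h0 : 0 ≤ r) (h1 : r < 1) :
    Summable fun s : Fin k → ℤ => r ^ ∑ i, (s i).natAbs := by
  refine summable_of_sum_le (c := ∏ _i : Fin k, ∑' z : ℤ, r ^ z.natAbs)
    (fun s => pow_nonneg h0 _) fun u => ?_
  calc ∑ s ∈ u, r ^ ∑ i, (s i).natAbs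
      ≤ ∑ s ∈ Fintype.piFinset fun i => u.image fun s => s i, r ^ ∑ i, (s i).natAbs := by
        refine Finset.sum_le_sum_of_subset_of_nonneg (fun s hs => ?_) fun _ _ _ => pow_nonneg h0 _
        rw [Fintype.mem_piFinset]
        exact fun i => Finset.mem_image_of_mem (fun s : Fin k → ℤ => s i) hs
    _ = ∏ i, ∑ z ∈ u.image fun s => s i, r ^ z.natAbs := by
        rw [Finset.prod_univ_sum]
        exact Finset.sum_congr rfl fun s _ => (Finset.prod_pow_eq_pow_sum _ _ _).symm
    _ ≤ ∏ _i : Fin k, ∑' z : ℤ, r ^ z.natAbs := by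
        refine Finset.prod_le_prod (fun i _ => Finset.sum_nonneg fun _ _ => pow_nonneg h0 _)
          fun i _ => ?_
        exact (summable_pow_natAbs h0 h1).sum_le_tsum _ fun _ _ => pow_nonneg h0 _

section Radial

variable {k : ℕ} {n : Fin k → ℕ} {K : Type*} [NormedAddCommGroup K] [InnerProductSpace ℂ K]

theorem inner_basisTensor_right (y : K) (ω : MultiWord n) (f : MultiFock n K) :
    inner ℂ f (basisTensor y ω) = inner ℂ (f ω) y := by
  rw [← inner_conj_symm, inner_basisTensor_left, inner_conj_symm]

theorem HasEntries.apply_eq_smul {m : Fin k → ℕ} {A : J n → K →L[ℂ] K}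
    {w : MultiWord n → MultiWord n → ℝ} {T Φ : MultiFock n K →L[ℂ] MultiFock n K}
    (hΦ : HasEntries m A w Φ) (hT : HasEntries m A (radialWeight 1) T) (ω γ : MultiWord n) (x : K) :
    (Φ (basisTensor x γ) : MultiFock n K) ω =
      ((w ω γ : ℝ) : ℂ) • (T (basisTensor x γ) : MultiFock n K) ω := by
  rw [hΦ, hT, radialWeight_one, Complex.ofReal_one, one_smul]

/-- The multiplier $r^{|s|}$ is a product over coordinates, so multiplying the one-variable Gram
factorizations gives one indexed by $\mathbb N^k$. On the diagonal it yields the bound on $\sum_l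
a_l^2$. -/
theorem HasEntries.opNorm_le {m : Fin k → ℕ} {A : J n → K →L[ℂ] K} {r : ℝ} (h0 : 0 ≤ r)
    (h1 : r ≤ 1) {T Φ : MultiFock n K →L[ℂ] MultiFock n K}
    (hΦ : HasEntries m A (radialWeight r) Φ) (hT : HasEntries m A (radialWeight 1) T) :
    ‖Φ‖ ≤ ‖T‖ := by
  have hr : r ^ 2 ≤ 1 := pow_le_one₀ h0 h1
  refine opNorm_le_of_schur (ι := Fin k → ℕ) T Φ (radialWeight r) (hΦ.apply_eq_smul hT) fun F => ?_
  -- A common bound for the word lengths in $F$ lets a single finite index set serve every entry.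
  let N : ℕ := F.sup fun γ => Finset.univ.sup fun i => (γ i).length
  have hN : ∀ γ ∈ F, ∀ i, (γ i).length ≤ N := fun γ hγ i =>
    (Finset.le_sup (f := fun i => (γ i).length) (Finset.mem_univ i)).trans
      (Finset.le_sup (f := fun γ : MultiWord n => Finset.univ.sup fun i => (γ i).length) hγ)
  let a : (Fin k → ℕ) → MultiWord n → ℝ := fun l γ => ∏ i, poissonCoeff r (l i) (γ i).length
  have key : ∀ ω ∈ F, ∀ γ ∈ F, radialWeight r ω γ =
      ∑ l ∈ Fintype.piFinset fun _ : Fin k => Finset.range (N + 1), a l ω * a l γ := by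
    intro ω hω γ hγ
    simp only [a, ← Finset.prod_mul_distrib]
    rw [← Finset.prod_univ_sum (fun _ : Fin k => Finset.range (N + 1)) fun i l =>
      poissonCoeff r l (ω i).length * poissonCoeff r l (γ i).length, radialWeight, ← Finset.prod_pow_eq_pow_sum]
    exact Finset.prod_congr rfl fun i _ =>
      (sum_poissonCoeff_mul_eq_pow_natAbs hr (hN ω hω i) (hN γ hγ i)).symm
  have hsq : ∀ γ ∈ F,
      ∑ l ∈ Fintype.piFinset fun _ : Fin k => Finset.range (N + 1), a l γ ^ 2 ≤ 1 := by
    intro γ hγ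
    simp only [sq]
    rw [← key γ hγ γ hγ, radialWeight]
    exact pow_le_one₀ h0 h1
  exact ⟨_, a, a, hsq, hsq, key⟩

/-- If `u_j` arises from `v` by multiplying the coordinates by scalars of modulus at most `1` which
tend to `1`, then `u_j → v`. -/
theorem tendsto_of_apply_eq_smul {ι : Type*} {l : Filter ι} (v : MultiFock n K)
    (u : ι → MultiFock n K) (w : ι → MultiWord n → ℝ)
    (hu : ∀ᶠ j in l, ∀ ω, u j ω = ((w j ω : ℝ) : ℂ) • v ω) (hw : ∀ᶠ j in l, ∀ ω, |w j ω| ≤ 1)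
    (hlim : ∀ ω, Tendsto (fun j => w j ω) l (𝓝 1)) : Tendsto u l (𝓝 v) := by
  have hsq : ∀ f : MultiFock n K, HasSum (fun ω => ‖f ω‖ ^ 2) (‖f‖ ^ 2) := fun f => by
    have := lp.hasSum_norm (E := fun _ : MultiWord n => K) (p := 2) (by norm_num) f
    simpa using this
  have h1 : Tendsto (fun j => ∑' ω, (w j ω - 1) ^ 2 * ‖v ω‖ ^ 2) l
      (𝓝 (∑' _ : MultiWord n, (0 : ℝ))) := by
    -- The constant is $(w-1)^2\le4$ for $|w|\le1$.
    refine tendsto_tsum_of_dominated_convergence (bound := fun ω => 4 * ‖v ω‖ ^ 2)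
      ((hsq v).summable.mul_left 4) (fun ω => ?_) ?_
    · have := (((hlim ω).sub_const 1).pow 2).mul_const (‖v ω‖ ^ 2)
      simpa using this
    · filter_upwards [hw] with j hj ω
      rw [Real.norm_of_nonneg (by positivity)]
      have := abs_le.1 (hj ω)
      gcongr
      nlinarith
  rw [tsum_zero] at h1
  rw [tendsto_iff_norm_sub_tendsto_zero]
  have h2 : Tendsto (fun j => ‖u j - v‖ ^ 2) l (𝓝 0) := by
    refine h1.congr' ?_
    filter_upwards [hu] with j hj
    rw [← (hsq (u j - v)).tsum_eq]
    refine tsum_congr fun ω => ?_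
    have e : (u j - v : MultiFock n K) ω = ((w j ω - 1 : ℝ) : ℂ) • v ω := by
      rw [lp.coeFn_sub, Pi.sub_apply, hj, Complex.ofReal_sub, sub_smul, Complex.ofReal_one,
        one_smul]
    rw [e, norm_smul, Complex.norm_real, mul_pow, Real.norm_eq_abs, sq_abs]
  have h3 := h2.sqrt
  simpa using h3

theorem dense_polynomials : Dense (polynomials n K : Set (MultiFock n K)) := fun f =>
  mem_closure_of_tendsto (hasSum_basisTensor f) (Eventually.of_forall fun _ =>
    Submodule.sum_mem _ fun _ _ => basisTensor_mem_polynomials _ _)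

theorem tendsto_radialWeight (ω γ : MultiWord n) :
    Tendsto (fun r : ℝ => radialWeight r ω γ) (𝓝[<] 1) (𝓝 1) := by
  have : Continuous fun r : ℝ => radialWeight r ω γ := continuous_pow _
  simpa [radialWeight_one] using (this.tendsto 1).mono_left nhdsWithin_le_nhds

theorem Ico_mem_nhdsLT_one : Ico (0 : ℝ) 1 ∈ 𝓝[<] (1 : ℝ) := Ico_mem_nhdsLT zero_lt_one

theorem tendsto_of_hasEntries {m : Fin k → ℕ} {A : J n → K →L[ℂ] K}
    {T : MultiFock n K →L[ℂ] MultiFock n K} {Φ : ℝ → MultiFock n K →L[ℂ] MultiFock n K}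
    (hΦ : ∀ r ∈ Ico (0 : ℝ) 1, HasEntries m A (radialWeight r) (Φ r))
    (hT : HasEntries m A (radialWeight 1) T) (ξ : MultiFock n K) :
    Tendsto (fun r => Φ r ξ) (𝓝[<] 1) (𝓝 (T ξ)) := by
  have hpoly : ∀ p ∈ polynomials n K, Tendsto (fun r => Φ r p) (𝓝[<] 1) (𝓝 (T p)) := by
    intro p hp
    induction hp using Submodule.span_induction with
    | mem v hv =>
      obtain ⟨x, γ, rfl⟩ := hv
      refine tendsto_of_apply_eq_smul _ _ (fun r ω => radialWeight r ω γ) ?_ ?_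
        fun ω => tendsto_radialWeight ω γ
      · filter_upwards [Ico_mem_nhdsLT_one] with r hr ω
        exact (hΦ r hr).apply_eq_smul hT ω γ x
      · filter_upwards [Ico_mem_nhdsLT_one] with r hr ω
        rw [radialWeight, abs_of_nonneg (pow_nonneg hr.1 _)]
        exact pow_le_one₀ hr.1 hr.2.le
    | zero => simp
    | add v w _ _ hv hw => simpa only [map_add] using hv.add hw
    | smul a v _ hv => simpa only [map_smul] using hv.const_smul a
  rw [Metric.tendsto_nhds]
  intro ε hε
  -- The two errors from replacing $\xi$ by $p$ each cost at most $\|T\|\|\xi-p\|$. The extra $2$ in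
  -- the denominator covers $T=0$ and leaves a positive part of $\varepsilon$ for the convergence at
  -- $p$.
  obtain ⟨p, hp, hpξ⟩ := Metric.mem_closure_iff.1 (dense_polynomials ξ) (ε / (2 * ‖T‖ + 2))
    (by positivity)
  rw [dist_eq_norm] at hpξ
  have hb : ‖T‖ * ‖ξ - p‖ ≤ ‖T‖ * (ε / (2 * ‖T‖ + 2)) := by gcongr
  have he : 2 * (‖T‖ * (ε / (2 * ‖T‖ + 2))) < ε := by
    rw [← mul_assoc, ← mul_div_assoc, div_lt_iff₀ (by positivity)]
    nlinarith
  filter_upwards [Ico_mem_nhdsLT_one, Metric.tendsto_nhds.1 (hpoly p hp)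
    (ε - 2 * (‖T‖ * (ε / (2 * ‖T‖ + 2)))) (by linarith)] with r hr h
  rw [dist_eq_norm] at h ⊢
  have e : Φ r ξ - T ξ = Φ r (ξ - p) + (Φ r p - T p) - T (ξ - p) := by
    simp only [map_sub]; abel
  have hn : ‖Φ r‖ ≤ ‖T‖ := (hΦ r hr).opNorm_le hr.1 hr.2.le hT
  have b1 : ‖Φ r (ξ - p)‖ ≤ ‖T‖ * ‖ξ - p‖ := (Φ r).le_of_opNorm_le hn _
  have b2 : ‖T (ξ - p)‖ ≤ ‖T‖ * ‖ξ - p‖ := T.le_opNorm _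
  rw [e]
  have t1 := norm_sub_le (Φ r (ξ - p) + (Φ r p - T p)) (T (ξ - p))
  have t2 := norm_add_le (Φ r (ξ - p)) (Φ r p - T p)
  linarith

/-- The Schur estimate gives the upper bound; lower semicontinuity of the norm under strong limits
makes it least. -/
theorem isLUB_norm_of_hasEntries {m : Fin k → ℕ} {A : J n → K →L[ℂ] K}
    {T : MultiFock n K →L[ℂ] MultiFock n K} {Φ : ℝ → MultiFock n K →L[ℂ] MultiFock n K}
    (hΦ : ∀ r ∈ Ico (0 : ℝ) 1, HasEntries m A (radialWeight r) (Φ r))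
    (hT : HasEntries m A (radialWeight 1) T) :
    IsLUB ((fun r : ℝ => ‖Φ r‖) '' Ico (0 : ℝ) 1) ‖T‖ := by
  constructor
  · rintro _ ⟨r, hr, rfl⟩
    exact (hΦ r hr).opNorm_le hr.1 hr.2.le hT
  · intro C hC
    have hC' : ∀ r ∈ Ico (0 : ℝ) 1, ‖Φ r‖ ≤ C := fun r hr => hC ⟨r, hr, rfl⟩
    have hC0 : 0 ≤ C := (norm_nonneg (Φ 0)).trans (hC' 0 ⟨le_rfl, zero_lt_one⟩)
    refine T.opNorm_le_bound hC0 fun ξ => ?_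
    refine le_of_tendsto (tendsto_of_hasEntries hΦ hT ξ).norm ?_
    filter_upwards [Ico_mem_nhdsLT_one] with r hr
    exact (Φ r).le_of_opNorm_le (hC' r hr) ξ

/-! ### Homogeneous parts, recovery of the operator, and column sums -/

variable [CompleteSpace K]

/-- Selecting degree $s$ is the multiplier $\sum_l 1_{l=|\omega|-s}\,1_{l=|\gamma|}$ over length
vectors $l$. For each word at most one $l$ contributes to either sum of squares. -/
theorem norm_homPart_le {m : Fin k → ℕ} {A : J n → K →L[ℂ] K}
    {T : MultiFock n K →L[ℂ] MultiFock n K} (hT : HasEntries m A (radialWeight 1) T)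
    (s : Fin k → ℤ) : ‖homPart m A s‖ ≤ ‖T‖ := by
  classical
  refine opNorm_le_of_schur (ι := Fin k → ℤ) T _ _ ((homPart_hasEntries m A s).apply_eq_smul hT)
    fun F => ?_
  let len : MultiWord n → Fin k → ℤ := fun γ i => (γ i).length
  refine ⟨F.image len, fun l γ => if l = len γ then 1 else 0,
    fun l ω => if l = len ω - s then 1 else 0, fun γ _ => ?_, fun ω _ => ?_, fun ω _ γ hγ => ?_⟩
  · simp only [ite_pow, one_pow, ne_eq, OfNat.ofNat_ne_zero, not_false_eq_true, zero_pow,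
      Finset.sum_ite_eq']
    split_ifs <;> norm_num
  · simp only [ite_pow, one_pow, ne_eq, OfNat.ofNat_ne_zero, not_false_eq_true, zero_pow,
      Finset.sum_ite_eq']
    split_ifs <;> norm_num
  · simp only [mul_ite, mul_one, mul_zero, Finset.sum_ite_eq']
    rw [if_pos (Finset.mem_image_of_mem len hγ)]
    have : degree ω γ = len ω - len γ := rfl
    rw [this]
    refine if_congr ?_ rfl rfl
    rw [sub_eq_iff_eq_add, eq_sub_iff_add_eq, add_comm, eq_comm]

theorem summable_radialTerm {m : Fin k → ℕ} {A : J n → K →L[ℂ] K} {M : ℝ}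
    (hM : ∀ s : Fin k → ℤ, ‖homPart m A s‖ ≤ M) {r : ℝ} (hr : r ∈ Ico (0 : ℝ) 1) :
    Summable (radialTerm m A r) := by
  refine Summable.of_norm_bounded ((summable_pow_sum_natAbs k hr.1 hr.2).mul_right M) fun s => ?_
  rw [radialTerm, norm_smul, Complex.norm_real, Real.norm_of_nonneg (pow_nonneg hr.1 _)]
  exact mul_le_mul_of_nonneg_left (hM s) (pow_nonneg hr.1 _)

/-- A weak limit along an ultrafilter finer than $r\to1^-$ has the right entries, since each entry
depends on $r$ only through a power of $r$. -/
theorem exists_hasEntries_one {m : Fin k → ℕ} {A : J n → K →L[ℂ] K} {C : ℝ}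
    (h : ∀ r ∈ Ico (0 : ℝ) 1, ∃ Φ : MultiFock n K →L[ℂ] MultiFock n K,
      HasEntries m A (radialWeight r) Φ ∧ ‖Φ‖ ≤ C) :
    ∃ T : MultiFock n K →L[ℂ] MultiFock n K, HasEntries m A (radialWeight 1) T := by
  choose! Φ hΦ hC using h
  let U : Ultrafilter ℝ := Ultrafilter.of (𝓝[<] (1 : ℝ))
  have hU : (U : Filter ℝ) ≤ 𝓝[<] 1 := Ultrafilter.of_le _
  obtain ⟨T, hT⟩ := exists_ultrafilter_tendsto_inner U Φ C
    (hU (mem_of_superset Ico_mem_nhdsLT_one hC))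
  refine ⟨T, fun ω γ x => ext_inner_right ℂ fun y => ?_⟩
  have h1 := hT (basisTensor x γ) (basisTensor y ω)
  simp only [inner_basisTensor_right] at h1
  have h2 : Tendsto (fun r : ℝ =>
      (inner ℂ (((radialWeight r ω γ : ℝ) : ℂ) • entry m A ω γ x) y : ℂ)) U
      (𝓝 (inner ℂ (((radialWeight 1 ω γ : ℝ) : ℂ) • entry m A ω γ x) y)) := by
    rw [radialWeight_one]
    exact (((Complex.continuous_ofReal.tendsto 1).comp
      ((tendsto_radialWeight ω γ).mono_left hU)).smul_const _).inner tendsto_const_nhds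
  refine tendsto_nhds_unique h1 (h2.congr' ?_)
  filter_upwards [hU Ico_mem_nhdsLT_one] with r hr
  rw [hΦ r hr]

/-- If the radial series converges on polynomials to vectors bounded by `C` on the unit ball, it
defines an operator of norm at most `C`. -/
theorem exists_hasEntries_of_hasValueAt {m : Fin k → ℕ} {A : J n → K →L[ℂ] K} {C r : ℝ}
    (h : ∀ p ∈ polynomials n K, ‖p‖ ≤ 1 → ∃ v : MultiFock n K, HasValueAt m A r p v ∧ ‖v‖ ≤ C) :
    ∃ Φ : MultiFock n K →L[ℂ] MultiFock n K, HasEntries m A (radialWeight r) Φ ∧ ‖Φ‖ ≤ C := by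
  have hC0 : 0 ≤ C := by
    obtain ⟨v, _, hv⟩ := h 0 (Submodule.zero_mem _) (by simp)
    exact (norm_nonneg v).trans hv
  -- Rescaling turns the bound on the unit ball into a homogeneous one, as needed for continuous
  -- extension.
  have h' : ∀ p : polynomials n K, ∃ v : MultiFock n K,
      HasValueAt m A r p v ∧ ‖v‖ ≤ C * ‖(p : MultiFock n K)‖ := by
    intro p
    by_cases hp : (p : MultiFock n K) = 0
    · refine ⟨0, ?_, by simp [hp]⟩
      simp only [HasValueAt, hp, map_zero, smul_zero]
      exact hasSum_zero
    · have hp' : 0 < ‖(p : MultiFock n K)‖ := norm_pos_iff.2 hp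
      obtain ⟨v, hv, hvC⟩ := h (((‖(p : MultiFock n K)‖⁻¹ : ℝ) : ℂ) • (p : MultiFock n K))
        (Submodule.smul_mem _ _ p.2) (by
          rw [norm_smul, Complex.norm_real, norm_inv, norm_norm, inv_mul_cancel₀ hp'.ne'])
      refine ⟨((‖(p : MultiFock n K)‖ : ℝ) : ℂ) • v, ?_, ?_⟩
      · have := HasSum.const_smul ((‖(p : MultiFock n K)‖ : ℝ) : ℂ) hv
        refine this.congr_fun fun c => ?_
        rw [map_smul, smul_comm _ (((‖(p : MultiFock n K)‖⁻¹ : ℝ) : ℂ)), smul_smul,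
          ← Complex.ofReal_mul, mul_inv_cancel₀ hp'.ne', Complex.ofReal_one, one_smul]
      · rw [norm_smul, Complex.norm_real, norm_norm, mul_comm]
        gcongr
  choose f hf hfC using h'
  -- Uniqueness of sums makes the chosen values linear.
  let F : polynomials n K →ₗ[ℂ] MultiFock n K :=
    { toFun := f
      map_add' := fun p q => (hf (p + q)).unique (by
        have := HasSum.add (hf p) (hf q)
        simpa only [Submodule.coe_add, map_add, smul_add] using this)
      map_smul' := fun a p => (hf (a • p)).unique (by
        have := HasSum.const_smul a (hf p)
        simpa only [Submodule.coe_smul, map_smul, smul_comm a, RingHom.id_apply] using this) }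
  have hd : DenseRange (polynomials n K).subtype := by
    rw [DenseRange, Submodule.coe_subtype, Subtype.range_coe]
    exact dense_polynomials
  refine ⟨F.extendOfNorm (polynomials n K).subtype, hasEntries_of_hasValueAt fun p hp => ?_,
    LinearMap.opNorm_extendOfNorm_le hd hC0 hfC⟩
  have := LinearMap.extendOfNorm_eq (f := F) hd ⟨C, hfC⟩ ⟨p, hp⟩
  rw [Submodule.subtype_apply] at this
  rw [this]
  exact hf ⟨p, hp⟩

theorem HasEntries.summable_wot {m : Fin k → ℕ} {A : J n → K →L[ℂ] K}
    {T : MultiFock n K →L[ℂ] MultiFock n K} (hT : HasEntries m A (radialWeight 1) T)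
    (γ : MultiWord n) :
    Summable fun ω : {ω : MultiWord n // Comparable ω γ} =>
      (ContinuousLinearMapWOT.ofCLM (((tau m ω.1 γ ^ 2 : ℝ) : ℂ) •
        (ContinuousLinearMap.adjoint (A (simplify ω.1 γ ω.2)) ∘L A (simplify ω.1 γ ω.2))) :
          K →WOT[ℂ] K) := by
  let E : K →L[ℂ] MultiFock n K :=
    T ∘L (basisTensorIsometry (K := K) γ).toContinuousLinearMap
  -- $E$ maps $x$ to $T(x\otimes e_\gamma)$; Parseval for $\langle Ey,Ex\rangle$ is the claimed
  -- series tested on vectors.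
  refine ⟨ContinuousLinearMapWOT.ofCLM (ContinuousLinearMap.adjoint E ∘L E), ?_⟩
  refine ContinuousLinearMapWOT.tendsto_iff_forall_inner_apply_tendsto.2 fun x y => ?_
  have hE : ∀ x ω, (E x : MultiFock n K) ω = entry m A ω γ x := fun x ω => by
    have := hT ω γ x
    rwa [radialWeight_one, Complex.ofReal_one, one_smul] at this
  have h1 : HasSum (fun ω => (inner ℂ (entry m A ω γ y) (entry m A ω γ x) : ℂ))
      (inner ℂ (E y) (E x)) := by
    simpa only [hE] using lp.hasSum_inner (𝕜 := ℂ) (E y) (E x)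
  have h2 : HasSum (fun ω : {ω // Comparable ω γ} =>
      (inner ℂ (entry m A ω.1 γ y) (entry m A ω.1 γ x) : ℂ)) (inner ℂ (E y) (E x)) := by
    refine (hasSum_subtype_iff_of_support_subset (s := {ω | Comparable ω γ})
      (f := fun ω => (inner ℂ (entry m A ω γ y) (entry m A ω γ x) : ℂ)) fun ω hω => ?_).2 h1
    by_contra hc
    refine hω ?_
    dsimp only
    rw [entry, dif_neg (show ¬Comparable ω γ from hc), _root_.zero_apply, inner_zero_left]
  rw [ContinuousLinearMapWOT.ofCLM_apply, ContinuousLinearMap.comp_apply,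
    ContinuousLinearMap.adjoint_inner_right]
  refine Tendsto.congr (fun s => ?_) h2
  have e : ∀ g : {ω : MultiWord n // Comparable ω γ} → K →L[ℂ] K,
      (∑ ω ∈ s, (ContinuousLinearMapWOT.ofCLM (g ω) : K →WOT[ℂ] K)) x = ∑ ω ∈ s, g ω x := by
    intro g
    induction s using Finset.cons_induction with
    | empty => simp
    | cons a s ha ih =>
      rw [Finset.sum_cons, Finset.sum_cons, ContinuousLinearMapWOT.add_apply, ih]
      rfl
  rw [e, inner_sum]
  refine Finset.sum_congr rfl fun ω _ => ?_
  dsimp only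
  rw [_root_.smul_apply, inner_smul_right, ContinuousLinearMap.comp_apply,
    ContinuousLinearMap.adjoint_inner_right, entry_of_comparable m A ω.2, _root_.smul_apply,
    _root_.smul_apply, inner_smul_left, inner_smul_right, Complex.conj_ofReal]
  push_cast
  ring

end Radial

end PolyHyperball

end

/-! ### The equivalences and the radial limit -/

theorem mainTheorem5 {k : ℕ} (n m : Fin k → ℕ) (hn : ∀ i, 1 ≤ n i) (hm : ∀ i, 1 ≤ m i)
    {K : Type*} [NormedAddCommGroup K] [InnerProductSpace ℂ K] [CompleteSpace K]
    (A : J n → K →L[ℂ] K) :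
    List.TFAE [
      -- (i)
      (∀ γ : MultiWord n, Summable fun ω : {ω : MultiWord n // Comparable ω γ} =>
        (ContinuousLinearMapWOT.ofCLM (((tau m ω.1 γ ^ 2 : ℝ) : ℂ) •
          (ContinuousLinearMap.adjoint (A (simplify ω.1 γ ω.2)) ∘L A (simplify ω.1 γ ω.2))) :
            K →WOT[ℂ] K)) ∧
      (∃ C : ℝ, ∀ r ∈ Ico (0 : ℝ) 1, ∀ p ∈ polynomials n K, ‖p‖ ≤ 1 →
        ∃ v : MultiFock n K, HasValueAt m A r p v ∧ ‖v‖ ≤ C),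
      -- (ii)
      ∃ T : MultiFock n K →L[ℂ] MultiFock n K,
        IsWeightedMultiToeplitz m T ∧ IsFourierRepresentation m A T,
      -- (iii)
      (∀ r ∈ Ico (0 : ℝ) 1, Summable (radialTerm m A r)) ∧
      (∃ C : ℝ, ∀ r ∈ Ico (0 : ℝ) 1, ‖radialSum m A r‖ ≤ C),
      -- (iv)
      (∃ M : ℝ, 0 < M ∧ ∀ s : Fin k → ℤ, ‖homPart m A s‖ ≤ M) ∧
      (∃ C : ℝ, ∀ r ∈ Ico (0 : ℝ) 1, ‖radialSum m A r‖ ≤ C)] ∧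
    ∀ T : MultiFock n K →L[ℂ] MultiFock n K,
      IsWeightedMultiToeplitz m T → IsFourierRepresentation m A T →
        (∀ ξ : MultiFock n K,
          Tendsto (fun r : ℝ => radialSum m A r ξ) (𝓝[<] 1) (𝓝 (T ξ))) ∧
        IsLUB ((fun r : ℝ => ‖radialSum m A r‖) '' Ico (0 : ℝ) 1) ‖T‖ := by
  have hrad : ∀ {T : MultiFock n K →L[ℂ] MultiFock n K}, HasEntries m A (radialWeight 1) T →
      ∀ r ∈ Ico (0 : ℝ) 1, HasEntries m A (radialWeight r) (radialSum m A r) := fun hT r hr =>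
    radialSum_hasEntries m A (summable_radialTerm (norm_homPart_le hT) hr)
  refine ⟨?_, fun T _ hF => ?_⟩
  · tfae_have 1 → 2 := by
      rintro ⟨-, C, hC⟩
      obtain ⟨T, hT⟩ := exists_hasEntries_one fun r hr => exists_hasEntries_of_hasValueAt (hC r hr)
      exact ⟨T, hT.isWeightedMultiToeplitz, isFourierRepresentation_iff.2 hT⟩
    tfae_have 2 → 4 := by
      rintro ⟨T, -, hF⟩
      have hT := isFourierRepresentation_iff.1 hF
      -- Adding $1$ keeps $M$ positive even when $T=0$.
      exact ⟨⟨‖T‖ + 1, by positivity, fun s => (norm_homPart_le hT s).trans (by linarith)⟩,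
        ‖T‖, fun r hr => (hrad hT r hr).opNorm_le hr.1 hr.2.le hT⟩
    tfae_have 4 → 3 := by
      rintro ⟨⟨M, -, hM⟩, hC⟩
      exact ⟨fun r hr => summable_radialTerm hM hr, hC⟩
    tfae_have 3 → 2 := by
      rintro ⟨hs, C, hC⟩
      obtain ⟨T, hT⟩ := exists_hasEntries_one fun r hr =>
        ⟨radialSum m A r, radialSum_hasEntries m A (hs r hr), hC r hr⟩
      exact ⟨T, hT.isWeightedMultiToeplitz, isFourierRepresentation_iff.2 hT⟩
    tfae_have 2 → 1 := by
      rintro ⟨T, -, hF⟩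
      have hT := isFourierRepresentation_iff.1 hF
      refine ⟨hT.summable_wot, ‖T‖, fun r hr p hp hp1 =>
        ⟨radialSum m A r p, (hrad hT r hr).hasValueAt hp, ?_⟩⟩
      refine ((radialSum m A r).le_of_opNorm_le
        ((hrad hT r hr).opNorm_le hr.1 hr.2.le hT) p).trans ?_
      exact mul_le_of_le_one_right (norm_nonneg T) hp1
    tfae_finish
  · have hT := isFourierRepresentation_iff.1 hF
    exact ⟨tendsto_of_hasEntries (hrad hT) hT, isLUB_norm_of_hasEntries (hrad hT) hT⟩
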